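/- Let $n\ge 1$ and let $\Gamma$ be a group of type $F_{n+1}$, generated by a finite set $S$. Let $X$ be the universal cover of a corresponding Eilenberg–MacLane space: a contractible simplicial complex with a free action of $\Gamma$ by simplicial automorphisms having finitely many orbits of simplices of dimension at most $n+1$. Fix a fundamental domain $F$, i.e. a set of simplices such that for every simplex $\sigma$ there is a unique $\gamma_\sigma\in\Gamma$ with $\gamma_\sigma\sigma\in F$. Let $\pi$ be a representation of $\Gamma$ on a (real or complex) Banach space $E$ by bounded invertible operators. Let $C^k$ be the space of alternating, $\Gamma$-invariant functions $f$ from the ordered $k$-simplices of $X$ to $E$; for $k\le n+1$ it is a Banach space under each of the equivalent norms $\|f\|_p=\big(\sum_{\sigma\in F^{(k)}}\|f(\sigma)\|^p\big)^{1/p}$, $1\le p<\infty$, where $F^{(k)}$ is the set of $k$-simplices in $F$. Put $$d^k_\pi f(\sigma)=\sum_{i=0}^{k+1}(-1)^i\,\pi_{\gamma_\sigma}\pi_{\gamma_{\sigma_i}}^{-1}f(\sigma_i),\qquad \sigma_i=(v_0,\dots,\widehat{v_i},\dots,v_{k+1}),$$ and $H^k(\Gamma,\pi)=\ker d^k_\pi/\operatorname{im}d^{k-1}_\pi$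 (with $\operatorname{im}d^{-1}_\pi=0$). This cohomology is called reduced if $\operatorname{im}d^{k-1}_\pi$ is closed in $C^k$. The $k$-th Kazhdan constant is $$\kappa_k(p,\pi)=\inf\Big\{\frac{\|d^k_\pi f\|_p}{\inf_{v\in\ker d^k_\pi}\|f+v\|_p}\;:\; f\in C^k\setminus\ker d^k_\pi\Big\}\in[0,\infty],\qquad \inf\emptyset=\infty .$$ A representation $\rho$ of $\Gamma$ on $E$ is an $\varepsilon$-deformation of $\pi$ if $\sup_{s\in S}\|\pi_s-\rho_s\|\le\varepsilon$. Assume that $H^n(\Gamma,\pi)=0$ and that $H^{n+1}(\Gamma,\pi)$ is reduced. Then there is $\varepsilon>0$, depending only on $\Gamma,S,X,F,\pi,n$, such that for every $\varepsilon$-deformation $\rho$ of $\pi$ $$H^n(\Gamma,\rho)=0$$ and $H^{n+1}(\Gamma,\rho)$ is reduced. Additionally, the Kazhdan constants of $\rho$ can be estimated: for every $1\le p<\infty$ there is a constant $A\ge 0$, depending only on these data and $p$, such that for every $0<\varepsilon'\le\varepsilon$ and every $\varepsilon'$-deformation $\rho$ of $\pi$, the operators $d^{n-1}_\pi-d^{n-1}_\rho$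 and $d^n_\pi-d^n_\rho$ have norm at most $A\varepsilon'$ with respect to $\|\cdot\|_p$, and $$\kappa_{n-1}(p,\rho)\ \ge\ \Big(1-\frac{2A\varepsilon'}{\kappa_n(p,\pi)}\Big)\kappa_{n-1}(p,\pi)-A\varepsilon',$$ $$\kappa_{n}(p,\rho)\ \ge\ \Big(1-\frac{2A\varepsilon'}{\kappa_{n-1}(p,\pi)}\Big)\kappa_{n}(p,\pi)-A\varepsilon',$$ where every difference on the right is replaced by $0$ if it is negative, and $0\cdot\infty=0$, $t/\infty=0$ for finite $t$. -/

import Mathlib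

open scoped ENNReal Topology

noncomputable section

namespace DeformCoh

universe u v w x

/-! ### Simplicial complexes, their realizations, and group actions on them -/

section Complexes

variable {V : Type v}

/-- The underlying set of the geometric realization of an abstract simplicial complex:
barycentric coordinates `c` on the vertices, nonnegative, of sum one, supported on a face. -/
def Realization (X : AbstractSimplicialComplex V) : Type v :=
  {c : V →₀ ℝ // (∀ a, 0 ≤ c a) ∧ (c.sum fun _ t => t) = 1 ∧ c.support ∈ X}

/-- The part of the realization carried by a face `s`: the closed simplex spanned by `s`. -/
def Realization.closedSimplex (X : AbstractSimplicialComplex V) (s : Finset V) :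
    Set (Realization X) :=
  {c | c.1.support ⊆ s}

/-- The barycentric coordinates with respect to `s` of the points of the closed simplex of `s`. -/
def Realization.coords (X : AbstractSimplicialComplex V) (s : Finset V) :
    Realization.closedSimplex X s → (s → ℝ) :=
  fun c a => c.1.1 a

/-- The weak topology: each closed simplex has its Euclidean topology, and a set is open iff its
trace on every closed simplex is open there. -/
instance (X : AbstractSimplicialComplex V) : TopologicalSpace (Realization X) :=
  ⨆ s : {s : Finset V // s ∈ X},
    TopologicalSpace.coinduced (Subtype.val : Realization.closedSimplex X s.1 → Realization X)
      (TopologicalSpace.induced (Realization.coords X s.1) inferInstance)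

variable {Γ : Type u} [Group Γ] [MulAction Γ V]

/-- The image `γ · s` of a finite set of vertices. -/
def translate (γ : Γ) (s : Finset V) : Finset V :=
  s.map (MulAction.toPerm γ).toEmbedding

/-- `X`, with the given action of `Γ`, is the universal cover of an Eilenberg-MacLane space of `Γ`
with finite `m`-skeleton: `X` is a contractible simplicial complex, on which `Γ` acts freely by
simplicial automorphisms, with finitely many orbits of simplices of dimension at most `m`. -/
structure IsEilenbergMacLane (Γ : Type u) [Group Γ] [MulAction Γ V]
    (X : AbstractSimplicialComplex V) (m : ℕ) : Prop where
  simplicial : ∀ (γ : Γ), ∀ s ∈ X, translate γ s ∈ X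
  free : ∀ (γ : Γ), ∀ s ∈ X, translate γ s = s → γ = 1
  contractible : ContractibleSpace (Realization X)
  finite_skeleton : ∃ T : Set (Finset V), T.Finite ∧
    ∀ s ∈ X, s.card ≤ m + 1 → ∃ γ : Γ, translate γ s ∈ T

/-- A fundamental domain: a set of simplices of `X` such that every simplex `s` of `X` is moved
into it by exactly one element of `Γ`. -/
structure FundamentalDomain (Γ : Type u) [Group Γ] [MulAction Γ V]
    (X : AbstractSimplicialComplex V) where
  carrier : Set (Finset V)
  subset : ∀ s ∈ carrier, s ∈ X
  existsUnique : ∀ s ∈ X, ∃! γ : Γ, translate γ s ∈ carrier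

/-- Ordered `k`-simplices `(v₀, …, v_k)` of `X`: the `v_i` are distinct and span a face. -/
def OrdSimplex (X : AbstractSimplicialComplex V) (k : ℕ) : Type v :=
  {σ : Fin (k + 1) ↪ V // Finset.univ.map σ ∈ X}

variable {X : AbstractSimplicialComplex V} {k : ℕ}

/-- The set of vertices of an ordered simplex. -/
def OrdSimplex.verts (σ : OrdSimplex X k) : Finset V := Finset.univ.map σ.1

/-- Reordering of the vertices of an ordered simplex. -/
def OrdSimplex.perm (σ : OrdSimplex X k) (e : Equiv.Perm (Fin (k + 1))) : OrdSimplex X k :=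
  ⟨e.toEmbedding.trans σ.1, by
    rw [← Finset.map_map, Finset.map_univ_equiv]; exact σ.2⟩

/-- The face `σ_i = (v₀, …, v̂_i, …, v_{k+1})`. -/
def OrdSimplex.face (σ : OrdSimplex X (k + 1)) (i : Fin (k + 2)) : OrdSimplex X k :=
  ⟨(Fin.succAboveEmb i).trans σ.1, by
    refine (X.isRelLowerSet_faces σ.2).2 ?_ ?_
    · rw [← Finset.map_map]
      exact Finset.map_subset_map.2 (Finset.subset_univ _)
    · exact Finset.map_nonempty.2 Finset.univ_nonempty⟩

/-- The element `γ_σ`, the unique `γ` such that `γ · σ` lies in the fundamental domain. -/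
def FundamentalDomain.toDomain (F : FundamentalDomain Γ X) (σ : OrdSimplex X k) : Γ :=
  (F.existsUnique σ.verts σ.2).choose

theorem FundamentalDomain.toDomain_spec (F : FundamentalDomain Γ X) (σ : OrdSimplex X k) :
    translate (F.toDomain σ) σ.verts ∈ F.carrier :=
  (F.existsUnique σ.verts σ.2).choose_spec.1

theorem FundamentalDomain.toDomain_unique (F : FundamentalDomain Γ X) (σ : OrdSimplex X k)
    {γ : Γ} (h : translate γ σ.verts ∈ F.carrier) : F.toDomain σ = γ :=
  ((F.existsUnique σ.verts σ.2).choose_spec.2 γ h).symm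

/-- The set `F^{(k)}` of the `k`-simplices of the fundamental domain. -/
def FundamentalDomain.simplices (F : FundamentalDomain Γ X) (k : ℕ) : Type v :=
  {s : Finset V // s ∈ F.carrier ∧ s.card = k + 1}

/-- Some ordering of the vertices of a `k`-simplex of the fundamental domain (norms of values of
alternating cochains do not depend on it). -/
def FundamentalDomain.order (F : FundamentalDomain Γ X) (s : F.simplices k) : OrdSimplex X k :=
  ⟨(s.1.equivFinOfCardEq s.2.2).symm.toEmbedding.trans (Function.Embedding.subtype _), by
    have h : Finset.univ.map ((s.1.equivFinOfCardEq s.2.2).symm.toEmbedding.trans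
        (Function.Embedding.subtype fun a => a ∈ s.1)) = s.1 := by
      rw [← Finset.map_map, Finset.map_univ_equiv, Finset.univ_eq_attach,
        Finset.attach_map_val]
    rw [h]
    exact F.subset _ s.2.1⟩

theorem OrdSimplex.verts_perm (σ : OrdSimplex X k) (e : Equiv.Perm (Fin (k + 1))) :
    (σ.perm e).verts = σ.verts := by
  simp only [OrdSimplex.verts, OrdSimplex.perm]
  rw [← Finset.map_map, Finset.map_univ_equiv]

theorem FundamentalDomain.toDomain_perm (F : FundamentalDomain Γ X) (σ : OrdSimplex X k)
    (e : Equiv.Perm (Fin (k + 1))) : F.toDomain (σ.perm e) = F.toDomain σ := by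
  apply F.toDomain_unique
  rw [OrdSimplex.verts_perm]
  exact F.toDomain_spec σ

theorem FundamentalDomain.toDomain_smul (F : FundamentalDomain Γ X) (σ τ : OrdSimplex X k)
    (γ : Γ) (h : ∀ i, τ.1 i = γ • σ.1 i) : F.toDomain σ = F.toDomain τ * γ := by
  apply F.toDomain_unique
  have h1 : τ.verts = translate γ σ.verts := by
    simp only [OrdSimplex.verts, translate, Finset.map_map]
    congr 1
    ext i
    simp [h i]
  have h2 := F.toDomain_spec τ
  rw [h1] at h2
  convert h2 using 1
  simp only [translate, Finset.map_map]
  congr 1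
  ext a
  simp [mul_smul]

end Complexes

/-! ### Cochains and the twisted codifferential -/

section Cochains

variable {V : Type v} {Γ : Type u} [Group Γ] [MulAction Γ V]
variable {𝕜 : Type w} [RCLike 𝕜] {E : Type x} [NormedAddCommGroup E] [NormedSpace 𝕜 E]

variable (Γ 𝕜 E) in
/-- The (untwisted) `k`-cochains: alternating functions on the ordered `k`-simplices with values in
`E` that are constant on the orbits of `Γ`. -/
def cochainSubmodule (X : AbstractSimplicialComplex V) (k : ℕ) : Submodule 𝕜 (OrdSimplex X k → E) where
  carrier := {f | (∀ σ (e : Equiv.Perm (Fin (k + 1))), f (σ.perm e) = Equiv.Perm.sign e • f σ) ∧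
    ∀ (γ : Γ) (σ τ : OrdSimplex X k), (∀ i, τ.1 i = γ • σ.1 i) → f τ = f σ}
  add_mem' := by
    rintro f g ⟨hf, hf'⟩ ⟨hg, hg'⟩
    refine ⟨fun σ e => ?_, fun γ σ τ h => ?_⟩
    · simp [hf σ e, hg σ e]
    · simp [hf' γ σ τ h, hg' γ σ τ h]
  zero_mem' := ⟨fun σ e => by simp, fun γ σ τ h => rfl⟩
  smul_mem' := by
    rintro c f ⟨hf, hf'⟩
    refine ⟨fun σ e => ?_, fun γ σ τ h => ?_⟩
    · simp [hf σ e, smul_comm c]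
    · simp [hf' γ σ τ h]

variable (Γ 𝕜 E) in
/-- The space `C^k(X, Γ, E)` of cochains. If there are finitely many orbits of `k`-simplices, every
cochain is `p`-integrable, for each `p`. -/
def Cochain (X : AbstractSimplicialComplex V) (k : ℕ) : Type _ :=
  cochainSubmodule Γ 𝕜 E X k

variable {X : AbstractSimplicialComplex V}

instance (k : ℕ) : AddCommGroup (Cochain Γ 𝕜 E X k) :=
  inferInstanceAs (AddCommGroup (cochainSubmodule Γ 𝕜 E X k))

instance (k : ℕ) : Module 𝕜 (Cochain Γ 𝕜 E X k) :=
  inferInstanceAs (Module 𝕜 (cochainSubmodule Γ 𝕜 E X k))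

/-- The topology of pointwise convergence on cochains. If there are finitely many orbits of
`k`-simplices, this is the topology of the norm `‖·‖_p` below, for each `p`. -/
instance (k : ℕ) : TopologicalSpace (Cochain Γ 𝕜 E X k) :=
  inferInstanceAs (TopologicalSpace (cochainSubmodule Γ 𝕜 E X k))

/-- The formula `d_π f (σ) = ∑ (-1)^i π(γ_σ) π(γ_{σ_i})⁻¹ f(σ_i)` for the twisted codifferential. -/
def coboundaryFun (F : FundamentalDomain Γ X) (π : Γ →* (E →L[𝕜] E)) (k : ℕ)
    (f : OrdSimplex X k → E) (σ : OrdSimplex X (k + 1)) : E :=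
  ∑ i : Fin (k + 2), (-1 : 𝕜) ^ (i : ℕ) •
    π (F.toDomain σ) (π (F.toDomain (σ.face i))⁻¹ (f (σ.face i)))

theorem exists_face_perm (k : ℕ) (e : Equiv.Perm (Fin (k + 2))) (i : Fin (k + 2)) :
    ∃ e' : Equiv.Perm (Fin (k + 1)),
      ((Equiv.Perm.sign e' : ℤˣ) : ℤ) * (-1) ^ (i : ℕ) =
        ((Equiv.Perm.sign e : ℤˣ) : ℤ) * (-1) ^ ((e i : Fin (k + 2)) : ℕ) ∧
      ∀ (X : AbstractSimplicialComplex V) (σ : OrdSimplex X (k + 1)),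
        (σ.perm e).face i = (σ.face (e i)).perm e' := by
  set q : Equiv.Perm (Fin (k + 2)) := (e i).cycleRange * e * (i.cycleRange)⁻¹ with hq
  have hq0 : q 0 = 0 := by
    simp [hq, Equiv.Perm.mul_apply, Equiv.Perm.inv_def]
  obtain ⟨⟨j, e'⟩, hje⟩ := Equiv.Perm.decomposeFin.symm.surjective q
  have hj : j = 0 := by
    rw [← hje] at hq0
    simpa using hq0
  subst hj
  have hs : Equiv.Perm.sign e' = Equiv.Perm.sign q := by
    rw [← hje]; simp
  refine ⟨e', ?_, fun X σ => ?_⟩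
  · rw [hs, hq]
    simp only [Equiv.Perm.sign_mul, Equiv.Perm.sign_inv, Fin.sign_cycleRange]
    push_cast
    have h1 : ((-1 : ℤ) ^ (i : ℕ)) * (-1) ^ (i : ℕ) = 1 := by
      rw [← mul_pow]; simp
    linear_combination ((-1 : ℤ) ^ ((e i : Fin (k + 2)) : ℕ) * (Equiv.Perm.sign e : ℤˣ)) * h1
  · apply Subtype.ext
    ext l
    have key : e (i.succAbove l) = (e i).succAbove (e' l) := by
      have h1 : q l.succ = (e' l).succ := by
        rw [← hje]; simp
      rw [← Fin.cycleRange_symm_succ, ← Fin.cycleRange_symm_succ, ← h1]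
      simp [hq, Equiv.Perm.mul_apply, Equiv.Perm.inv_def]
    simp [OrdSimplex.face, OrdSimplex.perm, key]

theorem coboundaryFun_mem (F : FundamentalDomain Γ X) (π : Γ →* (E →L[𝕜] E)) (k : ℕ)
    {f : OrdSimplex X k → E} (hf : f ∈ cochainSubmodule Γ 𝕜 E X k) :
    coboundaryFun F π k f ∈ cochainSubmodule Γ 𝕜 E X (k + 1) := by
  refine ⟨fun σ e => ?_, fun γ σ τ h => ?_⟩
  · unfold coboundaryFun
    rw [Finset.smul_sum]
    refine Eq.trans ?_ (Equiv.sum_comp e _)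
    refine Finset.sum_congr rfl fun i _ => ?_
    obtain ⟨e', hs, he'⟩ := exists_face_perm (V := V) k e i
    rw [he' X σ, F.toDomain_perm, F.toDomain_perm, hf.1, Units.smul_def, Units.smul_def,
      map_zsmul, map_zsmul, ← Int.cast_smul_eq_zsmul 𝕜, ← Int.cast_smul_eq_zsmul 𝕜, smul_smul,
      smul_smul]
    congr 1
    have := congrArg (Int.cast : ℤ → 𝕜) hs
    push_cast at this
    rw [← this, mul_comm]
  · unfold coboundaryFun
    refine Finset.sum_congr rfl fun i _ => ?_
    have hface : ∀ j, (τ.face i).1 j = γ • (σ.face i).1 j :=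
      fun j => h (i.succAbove j)
    rw [hf.2 γ _ _ hface, F.toDomain_smul _ _ γ h, F.toDomain_smul _ _ γ hface, mul_inv_rev,
      map_mul, map_mul, mul_apply_eq_comp, mul_apply_eq_comp,
      ← mul_apply_eq_comp (π γ), ← map_mul, mul_inv_cancel, map_one,
      one_apply_eq_self]

theorem coboundaryFun_add (F : FundamentalDomain Γ X) (π : Γ →* (E →L[𝕜] E)) (k : ℕ)
    (f g : OrdSimplex X k → E) :
    coboundaryFun F π k (f + g) = coboundaryFun F π k f + coboundaryFun F π k g := by
  funext σ
  simp [coboundaryFun, Finset.sum_add_distrib]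

theorem coboundaryFun_smul (F : FundamentalDomain Γ X) (π : Γ →* (E →L[𝕜] E)) (k : ℕ)
    (c : 𝕜) (f : OrdSimplex X k → E) :
    coboundaryFun F π k (c • f) = c • coboundaryFun F π k f := by
  funext σ
  simp [coboundaryFun, Finset.smul_sum, smul_comm c]

/-- The codifferential `d_π^k` from `k`-cochains to `(k+1)`-cochains. -/
def coboundary (F : FundamentalDomain Γ X) (π : Γ →* (E →L[𝕜] E)) (k : ℕ) :
    Cochain Γ 𝕜 E X k →ₗ[𝕜] Cochain Γ 𝕜 E X (k + 1) where
  toFun f := ⟨coboundaryFun F π k f.1, coboundaryFun_mem F π k f.2⟩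
  map_add' f g := Subtype.ext (coboundaryFun_add F π k f.1 g.1)
  map_smul' c f := Subtype.ext (coboundaryFun_smul F π k c f.1)

/-- The cocycles `ker d_π^k`. -/
def cocycles (F : FundamentalDomain Γ X) (π : Γ →* (E →L[𝕜] E)) (k : ℕ) :
    Submodule 𝕜 (Cochain Γ 𝕜 E X k) :=
  LinearMap.ker (coboundary F π k)

/-- The coboundaries `im d_π^{k-1}` (zero in degree `0`). -/
def coboundaries (F : FundamentalDomain Γ X) (π : Γ →* (E →L[𝕜] E)) :
    (k : ℕ) → Submodule 𝕜 (Cochain Γ 𝕜 E X k)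
  | 0 => ⊥
  | k + 1 => LinearMap.range (coboundary F π k)

/-- The cohomology `H^k(Γ, π) = ker d_π^k / im d_π^{k-1}`. -/
abbrev Cohomology (F : FundamentalDomain Γ X) (π : Γ →* (E →L[𝕜] E)) (k : ℕ) : Type _ :=
  cocycles F π k ⧸ (coboundaries F π k).submoduleOf (cocycles F π k)

/-- `H^k(Γ, π)` is reduced: the image `im d_π^{k-1}` is closed in the space of `k`-cochains. -/
def IsReduced (F : FundamentalDomain Γ X) (π : Γ →* (E →L[𝕜] E)) (k : ℕ) : Prop :=
  IsClosed (coboundaries F π k : Set (Cochain Γ 𝕜 E X k))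

/-- The norm `‖f‖_p = (∑_{σ ∈ F^{(k)}} ‖f(σ)‖^p)^{1/p}` on cochains. -/
def cochainNorm (F : FundamentalDomain Γ X) (p : ℝ) {k : ℕ} (f : Cochain Γ 𝕜 E X k) : ℝ :=
  (∑' s : F.simplices k, ‖f.1 (F.order s)‖ ^ p) ^ (1 / p)

/-- The Kazhdan constant `κ_k(Γ, X, p, π)`, the infimum of `‖d f‖ / inf_{v ∈ ker d} ‖f + v‖` over
the cochains `f ∉ ker d`, where `d = d_π^k` (an infimum over the empty set is `∞`). -/
def kazhdanConstant (F : FundamentalDomain Γ X) (p : ℝ) (π : Γ →* (E →L[𝕜] E)) (k : ℕ) : ℝ≥0∞ :=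
  ⨅ (f : Cochain Γ 𝕜 E X k) (_ : f ∉ cocycles F π k),
    ENNReal.ofReal (cochainNorm F p (coboundary F π k f)) /
      ⨅ v : cocycles F π k, ENNReal.ofReal (cochainNorm F p (f + v.1))

/-- `ρ` is an `ε`-deformation of `π` with respect to the finite set `S`:
`sup_{s ∈ S} ‖π_s - ρ_s‖ ≤ ε`. -/
def IsDeformation (S : Finset Γ) (ε : ℝ) (π ρ : Γ →* (E →L[𝕜] E)) : Prop :=
  ∀ s ∈ S, ‖π s - ρ s‖ ≤ ε

end Cochains

end DeformCoh

end

/-!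
A deformation `ρ` of `π` changes the twisted codifferentials little. The operators `π g - ρ g` grow
linearly in the distance on the generators (`exists_norm_sub_le_of_isDeformation`), and the norm of
`d_π f - d_ρ f` involves only the finitely many elements `γ_σ γ_{σ_i}⁻¹` with `σ` in the fundamental
domain (`exists_coboundary_sub_le`). So the theorem is about a pair of operators
`T : A → B`, `S : B → C` between Banach spaces with `ker S = im T` and `im S` closed, and operators
`T'`, `S'` with `S' T' = 0` at distance at most `δ` from them.

By the open mapping theorem both `T` and `S` admit lifts: values of norm `t` have preimages of norm at
most `t / r`, respectively `t / s`, and the suprema of the possible `r` and `s` are the Kazhdan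
constants of `T` and `S`.

* If `S' b = 0`, then `S b` has norm at most `δ ‖b‖`, so `b` is within `(δ / s) ‖b‖` of
  `ker S = im T`, and the element found there lifts along `T`. The lift solves `T' a = b` up to a
  relative error less than one, and iterating removes the error. This gives exactness and the
  estimate for `T'` (`exists_preimage_of_perturbation`); `1 - 2x ≤ (1 - x) / (1 + x)` brings the
  constant into the form of the theorem.
* If `f` is nearly the shortest element of its class modulo `ker S'`, the element of `ker S = im T`
  closest to `f` becomes an element of `ker S'` on replacing `T` by `T'`; hence `f` is nearly as far
  from `ker S` as from `ker S'`. This gives the estimate for `S'` and closed range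
  (`bounded_below_of_perturbation`, `isClosed_range_of_bounded_below`).

The first estimate avoids the passage to the dual complex. The spaces of cochains carry the topology
of pointwise convergence; values on representatives of the finitely many orbits of simplices
identify it with the topology of each norm `‖·‖_p` (`exists_isometric_model`).
-/

noncomputable section

namespace DeformCoh

universe u v w x

/-! ### Perturbation of exact sequences of Banach spaces -/

section Banach

variable {𝕜 : Type*} [RCLike 𝕜]
variable {A B C : Type*} [NormedAddCommGroup A] [NormedSpace 𝕜 A]
  [NormedAddCommGroup B] [NormedSpace 𝕜 B] [NormedAddCommGroup C] [NormedSpace 𝕜 C]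

/-- Every value of `T` has a preimage whose norm is at most `1 / r` times the norm of the value. -/
def LiftsWith (T : A →L[𝕜] B) (r : ℝ) : Prop :=
  ∀ a, ∃ a', T a' = T a ∧ r * ‖a'‖ ≤ ‖T a‖

/-- The abstract Kazhdan constant of an operator, the infimum of `‖T a‖ / dist(a, ker T)`. -/
def kappa (T : A →L[𝕜] B) : ℝ≥0∞ :=
  ⨅ (a : A) (_ : a ∉ T.ker),
    ENNReal.ofReal ‖T a‖ / ⨅ v : T.ker, ENNReal.ofReal ‖a + v.1‖

theorem iInf_ofReal_norm_add (K : Submodule 𝕜 A) (a : A) :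
    ⨅ v : K, ENNReal.ofReal ‖a + v.1‖ = ENNReal.ofReal ‖(Submodule.Quotient.mk a : A ⧸ K)‖ := by
  refine le_antisymm (ENNReal.le_of_forall_pos_le_add fun ε hε _ => ?_) (le_iInf fun v => ?_)
  · obtain ⟨m, hm, hlt⟩ := Submodule.Quotient.norm_mk_lt (Submodule.Quotient.mk a : A ⧸ K)
      (NNReal.coe_pos.2 hε)
    refine (iInf_le _ ⟨m - a, (Submodule.Quotient.eq K).1 hm⟩).trans ?_
    rw [← ENNReal.ofReal_coe_nnreal, ← ENNReal.ofReal_add (norm_nonneg _) (NNReal.coe_nonneg ε)]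
    exact ENNReal.ofReal_le_ofReal (by simpa using hlt.le)
  · refine ENNReal.ofReal_le_ofReal ?_
    have h : (Submodule.Quotient.mk a : A ⧸ K) = Submodule.Quotient.mk (a + v.1) :=
      (Submodule.Quotient.eq K).2 (by simp)
    rw [h]
    exact Submodule.Quotient.norm_mk_le _ _

theorem norm_mk_pos_of_notMem_ker (T : A →L[𝕜] B) {a : A} (ha : a ∉ T.ker) :
    0 < ‖(Submodule.Quotient.mk a : A ⧸ T.ker)‖ := by
  refine lt_of_le_of_ne (norm_nonneg _) fun h => ha ?_
  have := (QuotientAddGroup.norm_mk_eq_zero_iff_mem_closure (S := T.ker.toAddSubgroup)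
    (m := a)).1 h.symm
  have hc : IsClosed ((T.ker : Submodule 𝕜 A) : Set A) := T.isClosed_ker
  exact hc.closure_subset this

theorem ofReal_le_kappa_iff (T : A →L[𝕜] B) {r : ℝ} (hr : 0 ≤ r) :
    ENNReal.ofReal r ≤ kappa T ↔
      ∀ a, r * ‖(Submodule.Quotient.mk a : A ⧸ T.ker)‖ ≤ ‖T a‖ := by
  simp only [kappa, iInf_ofReal_norm_add, le_iInf_iff]
  refine forall_congr' fun a => ?_
  by_cases ha : a ∈ T.ker
  · have h0 : (Submodule.Quotient.mk a : A ⧸ T.ker) = 0 :=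
      (Submodule.Quotient.mk_eq_zero _).2 ha
    simp [ha, h0]
  · have hpos := norm_mk_pos_of_notMem_ker T ha
    simp only [ha, not_false_eq_true, forall_const]
    rw [ENNReal.le_div_iff_mul_le (Or.inl (ENNReal.ofReal_pos.2 hpos).ne')
        (Or.inl ENNReal.ofReal_ne_top),
      ← ENNReal.ofReal_mul hr, ENNReal.ofReal_le_ofReal_iff (norm_nonneg _)]

theorem liftsWith_of_lt_kappa (T : A →L[𝕜] B) {r : ℝ} (hr : 0 < r)
    (h : ENNReal.ofReal r < kappa T) : LiftsWith T r := by
  obtain ⟨q, hrq, hq⟩ := ENNReal.lt_iff_exists_nnreal_btwn.1 h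
  rw [← ENNReal.ofReal_coe_nnreal] at hrq hq
  have hrq' : r < q := by
    rwa [ENNReal.ofReal_lt_ofReal_iff_of_nonneg hr.le] at hrq
  have hl := (ofReal_le_kappa_iff T (NNReal.coe_nonneg q)).1 hq.le
  intro a
  rcases eq_or_ne (T a) 0 with h0 | h0
  · exact ⟨0, by simp [h0], by simp⟩
  have h1 : ‖(Submodule.Quotient.mk a : A ⧸ T.ker)‖ < ‖T a‖ / r := by
    rw [lt_div_iff₀ hr]
    have hpos := norm_mk_pos_of_notMem_ker T (a := a) (by simpa using h0)
    have := mul_lt_mul_of_pos_right hrq' hpos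
    linarith [hl a]
  obtain ⟨m, hm, hlt⟩ := Submodule.Quotient.norm_mk_lt (Submodule.Quotient.mk a : A ⧸ T.ker)
    (sub_pos.2 h1)
  refine ⟨m, ?_, ?_⟩
  · have := (Submodule.Quotient.eq T.ker).1 hm
    simpa [sub_eq_zero] using this
  · rw [add_sub_cancel, lt_div_iff₀ hr] at hlt
    linarith

theorem LiftsWith.ofReal_le_kappa {T : A →L[𝕜] B} {r : ℝ} (hr : 0 ≤ r) (h : LiftsWith T r) :
    ENNReal.ofReal r ≤ kappa T := by
  refine (ofReal_le_kappa_iff T hr).2 fun a => ?_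
  obtain ⟨a', ha', hle⟩ := h a
  have he : (Submodule.Quotient.mk a : A ⧸ T.ker) = Submodule.Quotient.mk a' :=
    (Submodule.Quotient.eq _).2 (by simp [ha'])
  rw [he]
  exact (mul_le_mul_of_nonneg_left (Submodule.Quotient.norm_mk_le _ _) hr).trans hle

/-- The open mapping theorem: an operator with closed range has a positive lifting constant. -/
theorem exists_liftsWith_of_isClosed_range [CompleteSpace A] [CompleteSpace B] (T : A →L[𝕜] B)
    (h : IsClosed (T.range : Set B)) : ∃ r : ℝ, 0 < r ∧ LiftsWith T r := by
  have : CompleteSpace T.range := h.completeSpace_coe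
  obtain ⟨M, hM, hM'⟩ := (T.codRestrict T.range fun a => ⟨a, rfl⟩).exists_preimage_norm_le
    (fun ⟨b, a, ha⟩ => ⟨a, Subtype.ext ha⟩)
  refine ⟨M⁻¹, inv_pos.2 hM, fun a => ?_⟩
  obtain ⟨a', ha', hle⟩ := hM' ⟨T a, a, rfl⟩
  refine ⟨a', congrArg Subtype.val ha', ?_⟩
  rw [inv_mul_le_iff₀ hM]
  exact hle

/-- Successive approximation: if elements of a set `K` can be approximated by values of `T` with
relative error `θ < 1` at cost `M`, with errors in `K` again, then they are values of `T` at cost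
 `M / (1 - θ)`. -/
theorem exists_preimage_of_approx [CompleteSpace A] (T : A →L[𝕜] B) (K : Set B) {M θ : ℝ}
    (hM : 0 ≤ M) (hθ0 : 0 ≤ θ) (hθ : θ < 1)
    (h : ∀ b ∈ K, ∃ a, ‖a‖ ≤ M * ‖b‖ ∧ b - T a ∈ K ∧ ‖b - T a‖ ≤ θ * ‖b‖) :
    ∀ b ∈ K, ∃ a, T a = b ∧ (1 - θ) * ‖a‖ ≤ M * ‖b‖ := by
  intro b hb
  choose! g hg1 hg2 hg3 using h
  let u : ℕ → B := fun m => (fun c => c - T (g c))^[m] b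
  have hu : ∀ m, u (m + 1) = u m - T (g (u m)) := fun m =>
    Function.iterate_succ_apply' _ _ _
  have huK : ∀ m, u m ∈ K := by
    intro m
    induction m with
    | zero => exact hb
    | succ m ih => rw [hu]; exact hg2 _ ih
  have hun : ∀ m, ‖u m‖ ≤ θ ^ m * ‖b‖ := by
    intro m
    induction m with
    | zero => simp [u]
    | succ m ih =>
      rw [hu, pow_succ', mul_assoc]
      exact (hg3 _ (huK m)).trans (mul_le_mul_of_nonneg_left ih hθ0)
  have hgn : ∀ m, ‖g (u m)‖ ≤ M * ‖b‖ * θ ^ m := fun m => by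
    have := mul_le_mul_of_nonneg_left (hun m) hM
    linarith [hg1 _ (huK m)]
  have hsum : HasSum (fun m => M * ‖b‖ * θ ^ m) (M * ‖b‖ * (1 - θ)⁻¹) :=
    (hasSum_geometric_of_lt_one hθ0 hθ).mul_left _
  have hs : Summable fun m => g (u m) := Summable.of_norm_bounded hsum.summable hgn
  refine ⟨∑' m, g (u m), ?_, ?_⟩
  · have h1 : Filter.Tendsto (fun m => ∑ i ∈ Finset.range m, T (g (u i))) Filter.atTop
        (𝓝 (T (∑' m, g (u m)))) := (T.hasSum hs.hasSum).tendsto_sum_nat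
    have h2 : ∀ m, ∑ i ∈ Finset.range m, T (g (u i)) = b - u m := by
      intro m
      induction m with
      | zero => simp [u]
      | succ m ih => rw [Finset.sum_range_succ, ih, hu]; abel
    have h3 : Filter.Tendsto u Filter.atTop (𝓝 0) := by
      refine squeeze_zero_norm hun ?_
      simpa using (tendsto_pow_atTop_nhds_zero_of_lt_one hθ0 hθ).mul_const ‖b‖
    simp only [h2] at h1
    exact tendsto_nhds_unique h1 (by simpa using h3.const_sub b)
  · have h1 := tsum_of_norm_bounded hsum hgn
    rw [← div_eq_mul_inv, le_div_iff₀ (by linarith)] at h1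
    linarith

/-- A closed-range criterion: an operator that is bounded below modulo its kernel has closed
range. -/
theorem isClosed_range_of_bounded_below [CompleteSpace A] (T : A →L[𝕜] B) {r : ℝ} (hr : 0 < r)
    (h : ∀ a, r * ‖(Submodule.Quotient.mk a : A ⧸ T.ker)‖ ≤ ‖T a‖) :
    IsClosed (T.range : Set B) := by
  have hl : LiftsWith T (r / 2) := by
    refine liftsWith_of_lt_kappa T (half_pos hr)
      (lt_of_lt_of_le ?_ ((ofReal_le_kappa_iff T hr.le).2 h))
    exact (ENNReal.ofReal_lt_ofReal_iff hr).2 (half_lt_self hr)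
  refine isClosed_of_closure_subset fun b hb => ?_
  have hstep : ∀ b ∈ closure (T.range : Set B), ∃ a, ‖a‖ ≤ 3 / r * ‖b‖ ∧
      b - T a ∈ closure (T.range : Set B) ∧ ‖b - T a‖ ≤ 1 / 2 * ‖b‖ := by
    intro b hb
    rcases eq_or_ne b 0 with rfl | h0
    · exact ⟨0, by simp, by simpa using hb, by simp⟩
    obtain ⟨_, ⟨a, rfl⟩, hlt⟩ := Metric.mem_closure_iff.1 hb (1 / 2 * ‖b‖)
      (by have := norm_pos_iff.2 h0; positivity)
    obtain ⟨a', ha', hle⟩ := hl a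
    have hlt' : ‖b - T a'‖ < 1 / 2 * ‖b‖ := by rw [ha']; rwa [dist_eq_norm] at hlt
    refine ⟨a', ?_, ?_, hlt'.le⟩
    · have h1 : ‖T a'‖ ≤ ‖b‖ + ‖b - T a'‖ := by
        simpa using norm_sub_le b (b - T a')
      rw [← ha'] at hle
      rw [div_mul_eq_mul_div, le_div_iff₀ hr]
      linarith
    · have hcl : T.range.topologicalClosure.carrier = closure (T.range : Set B) := rfl
      exact T.range.topologicalClosure.sub_mem hb (subset_closure ⟨a', rfl⟩)
  obtain ⟨a, ha, -⟩ := exists_preimage_of_approx T _ (by positivity) (by norm_num) (by norm_num)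
    hstep b hb
  exact ⟨a, ha⟩

variable {T T' : A →L[𝕜] B} {S S' : B →L[𝕜] C} {δ r s : ℝ}

/-- Stability of exactness. A cocycle `b` of the perturbed complex is within `(δ / s) ‖b‖` of a
cocycle of the original one, which lifts along `T`; the lift solves `T' a = b` up to a small relative
error, and successive approximation removes the error. -/
theorem exists_preimage_of_perturbation [CompleteSpace A]
    (hex : ∀ b, S b = 0 → ∃ a, T a = b) (hzero : ∀ a, S' (T' a) = 0)
    (hδ : 0 ≤ δ) (hT : ∀ a, ‖T a - T' a‖ ≤ δ * ‖a‖) (hS : ∀ b, ‖S b - S' b‖ ≤ δ * ‖b‖)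
    (hr : 0 < r) (hTr : LiftsWith T r) (hs : 0 < s) (hSs : LiftsWith S s)
    (hpos : 0 < (1 - 2 * δ / s) * r - δ) (b : B) (hb : S' b = 0) :
    ∃ a, T' a = b ∧ ((1 - 2 * δ / s) * r - δ) * ‖a‖ ≤ ‖b‖ := by
  set x := δ / s with hx
  set y := δ / r with hy
  have hx0 : 0 ≤ x := by positivity
  have hy0 : 0 ≤ y := by positivity
  have hxs : x * s = δ := by rw [hx]; field_simp
  have hyr : y * r = δ := by rw [hy]; field_simp
  have hxx : 2 * δ / s = 2 * x := by rw [hx]; ring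
  rw [hxx] at hpos ⊢
  have hpos' : 0 < 1 - 2 * x - y := by
    have : 0 < (1 - 2 * x - y) * r := by rw [← hyr] at hpos; linarith
    exact pos_of_mul_pos_left this hr.le
  set θ := x + (1 + x) * y with hθ
  have hθ1 : (1 - 2 * x - y) * (1 + x) ≤ 1 - θ := by rw [hθ]; nlinarith [mul_nonneg hx0 hx0]
  have hθ2 : 0 < 1 - θ := lt_of_lt_of_le (by positivity) hθ1
  have hstep : ∀ b ∈ {b | S' b = 0}, ∃ a, ‖a‖ ≤ (1 + x) / r * ‖b‖ ∧
      b - T' a ∈ {b | S' b = 0} ∧ ‖b - T' a‖ ≤ θ * ‖b‖ := by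
    intro b (hb' : S' b = 0)
    obtain ⟨b', hb1, hb2⟩ := hSs b
    have hb3 : ‖b'‖ ≤ x * ‖b‖ := by
      have h1 := hS b
      rw [hb', sub_zero, ← hxs] at h1
      exact le_of_mul_le_mul_left (by linarith : s * ‖b'‖ ≤ s * (x * ‖b‖)) hs
    obtain ⟨a₀, ha₀⟩ := hex (b - b') (by rw [map_sub, hb1, sub_self])
    obtain ⟨a, ha, hale⟩ := hTr a₀
    rw [ha₀] at ha hale
    have h1 : ‖b - b'‖ ≤ (1 + x) * ‖b‖ := by linarith [norm_sub_le b b']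
    have h2 : ‖a‖ ≤ (1 + x) / r * ‖b‖ := by
      rw [div_mul_eq_mul_div, le_div_iff₀ hr]; linarith
    refine ⟨a, h2, by simp [hb', hzero], ?_⟩
    have h3 : b - T' a = b' + (T a - T' a) := by rw [ha]; abel
    have h4 : δ * ((1 + x) / r * ‖b‖) = (1 + x) * y * ‖b‖ := by rw [hy]; ring
    rw [h3, hθ, add_mul, ← h4]
    exact (norm_add_le _ _).trans
      (add_le_add hb3 ((hT a).trans (mul_le_mul_of_nonneg_left h2 hδ)))
  obtain ⟨a, ha, hle⟩ := exists_preimage_of_approx T' _ (by positivity) (by positivity)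
    (by linarith) hstep b hb
  refine ⟨a, ha, ?_⟩
  have h1 : ((1 - 2 * x - y) * (1 + x)) * ‖a‖ ≤ (1 + x) / r * ‖b‖ :=
    (mul_le_mul_of_nonneg_right hθ1 (norm_nonneg _)).trans hle
  have h2 : (1 + x) * (((1 - 2 * x) * r - δ) * ‖a‖) ≤ (1 + x) * ‖b‖ := by
    have h3 := mul_le_mul_of_nonneg_left h1 hr.le
    have h4 : r * ((1 + x) / r * ‖b‖) = (1 + x) * ‖b‖ := by field_simp
    rw [h4] at h3
    rw [← hyr]
    linarith
  exact le_of_mul_le_mul_left h2 (by positivity)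

/-- Stability of the lower bound for the outgoing operator: a nearly optimal representative of a
class modulo `ker S'` is compared with a nearby element of `ker S = im T`, which is moved into
`ker S'` by replacing `T` with `T'`. -/
theorem bounded_below_of_perturbation
    (hex : ∀ b, S b = 0 → ∃ a, T a = b) (hzero : ∀ a, S' (T' a) = 0)
    (hδ : 0 ≤ δ) (hT : ∀ a, ‖T a - T' a‖ ≤ δ * ‖a‖) (hS : ∀ b, ‖S b - S' b‖ ≤ δ * ‖b‖)
    (hr : 0 < r) (hTr : LiftsWith T r) (hs : 0 < s) (hSs : LiftsWith S s) (b : B) :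
    ((1 - 2 * δ / r) * s - δ) * ‖(Submodule.Quotient.mk b : B ⧸ S'.ker)‖ ≤ ‖S' b‖ := by
  set D := ‖(Submodule.Quotient.mk b : B ⧸ S'.ker)‖ with hD
  set c := δ + s * (2 * δ / r) with hc
  have hc0 : 0 ≤ c := by positivity
  -- The estimate for an arbitrary representative; the representatives of norm close to `D` give
  -- the claim.
  have key : ∀ f, S' f = S' b → s * D ≤ ‖S' b‖ + c * ‖f‖ := by
    intro f hf
    obtain ⟨g, hg1, hg2, hg3⟩ : ∃ g, S g = S f ∧ s * ‖g‖ ≤ ‖S f‖ ∧ ‖g‖ ≤ ‖f‖ := by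
      by_cases h : s * ‖f‖ ≤ ‖S f‖
      · exact ⟨f, rfl, h, le_rfl⟩
      · obtain ⟨g, hg, hle⟩ := hSs f
        exact ⟨g, hg, hle, le_of_mul_le_mul_left (hle.trans (not_le.1 h).le) hs⟩
    obtain ⟨a₀, ha₀⟩ := hex (f - g) (by rw [map_sub, hg1, sub_self])
    obtain ⟨a, ha, hale⟩ := hTr a₀
    rw [ha₀] at ha hale
    have h1 : r * ‖a‖ ≤ 2 * ‖f‖ := by linarith [norm_sub_le f g]
    have h2 : D ≤ ‖f - T' a‖ := by
      have he : (Submodule.Quotient.mk b : B ⧸ S'.ker) = Submodule.Quotient.mk (f - T' a) :=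
        (Submodule.Quotient.eq _).2 (by simp [hf, hzero])
      rw [hD, he]
      exact Submodule.Quotient.norm_mk_le _ _
    have h3 : f - T' a = g + (T a - T' a) := by rw [ha]; abel
    have h4 : ‖a‖ ≤ 2 * ‖f‖ / r := by rw [le_div_iff₀ hr]; linarith
    have h5 : D ≤ ‖g‖ + δ * (2 * ‖f‖ / r) := by
      rw [h3] at h2
      exact h2.trans ((norm_add_le _ _).trans
        (add_le_add le_rfl ((hT a).trans (mul_le_mul_of_nonneg_left h4 hδ))))
    have h6 : ‖S f‖ ≤ ‖S' b‖ + δ * ‖f‖ := by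
      have := norm_add_le (S' f) (S f - S' f)
      rw [add_sub_cancel, hf] at this
      rw [← hf] at this ⊢
      linarith [hS f]
    have h7 := mul_le_mul_of_nonneg_left h5 hs.le
    have h8 : s * (‖g‖ + δ * (2 * ‖f‖ / r)) = s * ‖g‖ + s * (2 * δ / r) * ‖f‖ := by ring
    rw [hc, add_mul]
    linarith
  have h : s * D ≤ ‖S' b‖ + c * D := by
    refine le_of_forall_pos_le_add fun ε hε => ?_
    obtain ⟨f, hf, hlt⟩ := Submodule.Quotient.norm_mk_lt (Submodule.Quotient.mk b : B ⧸ S'.ker)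
      (ε := ε / (c + 1)) (by positivity)
    have hf' : S' f = S' b := by
      have := (Submodule.Quotient.eq S'.ker).1 hf
      simpa [sub_eq_zero] using this
    have h1 : c * ‖f‖ ≤ c * (D + ε / (c + 1)) := mul_le_mul_of_nonneg_left hlt.le hc0
    have h2 : c * (ε / (c + 1)) ≤ ε := by
      rw [mul_div_assoc', div_le_iff₀ (by positivity)]
      nlinarith
    linarith [key f hf', mul_add c D (ε / (c + 1))]
  have h' : (1 - 2 * δ / r) * s - δ = s - c := by rw [hc]; ring
  rw [h', sub_mul]
  linarith

/-- To bound `(1 - 2δ / κ₁) κ₂ - δ` from above, with truncated subtraction and the conventions of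
`ℝ≥0∞`, it suffices to treat positive real numbers below `κ₁` and `κ₂`. -/
theorem tsub_mul_tsub_le_of_forall_lt {κ₁ κ₂ K : ℝ≥0∞} (h₁ : κ₁ ≠ 0) (hδ : 0 ≤ δ)
    (h : ∀ x y : ℝ, 0 < x → 0 < y → ENNReal.ofReal x < κ₁ → ENNReal.ofReal y < κ₂ →
      0 < (1 - 2 * δ / x) * y - δ → ENNReal.ofReal ((1 - 2 * δ / x) * y - δ) ≤ K) :
    (1 - 2 * ENNReal.ofReal δ / κ₁) * κ₂ - ENNReal.ofReal δ ≤ K := by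
  rw [tsub_le_iff_right]
  refine ENNReal.mul_le_of_forall_lt fun a ha b hb => ?_
  rcases eq_or_ne b 0 with rfl | hb0
  · simp
  have ha1 : a < 1 := lt_of_lt_of_le ha tsub_le_self
  have hbt : b ≠ ∞ := (lt_top_of_lt hb).ne
  lift a to NNReal using (lt_top_of_lt ha).ne
  lift b to NNReal using hbt
  have ha1' : a < 1 := by exact_mod_cast ha1
  have h2 : 2 * ENNReal.ofReal δ / κ₁ < ENNReal.ofReal (1 - a) := by
    have h3 := lt_tsub_iff_right.1 ha
    rw [add_comm] at h3
    have h4 := lt_tsub_iff_right.2 h3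
    rwa [ENNReal.ofReal_sub _ (NNReal.coe_nonneg a), ENNReal.ofReal_one, ENNReal.ofReal_coe_nnreal]
  have h0a : (0 : ℝ) < 1 - a := sub_pos.2 (by exact_mod_cast ha1')
  have h3 : ENNReal.ofReal (2 * δ / (1 - a)) < κ₁ := by
    rw [ENNReal.div_lt_iff (Or.inl h₁) (Or.inr (by finiteness)), mul_comm _ κ₁] at h2
    rw [ENNReal.ofReal_div_of_pos h0a, ENNReal.ofReal_mul two_pos.le]
    refine ENNReal.div_lt_of_lt_mul ?_
    simpa using h2
  obtain ⟨x, hx1, hx2⟩ := ENNReal.lt_iff_exists_nnreal_btwn.1 h3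
  rw [← ENNReal.ofReal_coe_nnreal] at hx1 hx2
  have hx3 : 2 * δ / (1 - a) < x := by
    rwa [ENNReal.ofReal_lt_ofReal_iff_of_nonneg (by positivity)] at hx1
  have hx0 : (0 : ℝ) < x := lt_of_le_of_lt (by positivity) hx3
  have hax : (a : ℝ) ≤ 1 - 2 * δ / x := by
    rw [div_lt_iff₀ h0a] at hx3
    have : 2 * δ / x ≤ 1 - a := by rw [div_le_iff₀ hx0]; linarith
    linarith
  have hb0' : (0 : ℝ) < b := by
    have : b ≠ 0 := by exact_mod_cast hb0
    exact_mod_cast pos_iff_ne_zero.2 this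
  have hab : (a * b : ℝ) ≤ (1 - 2 * δ / x) * b := mul_le_mul_of_nonneg_right hax hb0'.le
  have hK : ENNReal.ofReal ((1 - 2 * δ / x) * b - δ) ≤ K := by
    rcases lt_or_ge 0 ((1 - 2 * δ / x) * b - δ) with hp | hp
    · exact h x b hx0 hb0' hx2 (by rwa [ENNReal.ofReal_coe_nnreal]) hp
    · rw [ENNReal.ofReal_of_nonpos hp]; exact zero_le
  calc (a : ℝ≥0∞) * b = ENNReal.ofReal (a * b) := by
        rw [ENNReal.ofReal_mul (NNReal.coe_nonneg a), ENNReal.ofReal_coe_nnreal,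
          ENNReal.ofReal_coe_nnreal]
    _ ≤ ENNReal.ofReal (((1 - 2 * δ / x) * b - δ) + δ) :=
        ENNReal.ofReal_le_ofReal (by linarith)
    _ ≤ ENNReal.ofReal ((1 - 2 * δ / x) * b - δ) + ENNReal.ofReal δ := ENNReal.ofReal_add_le
    _ ≤ K + ENNReal.ofReal δ := by gcongr

/-- The Kazhdan constants of a perturbed complex. Positivity of the original constants excludes
only the convention `0 / 0 = 0` in the quotients on the left. -/
theorem kappa_perturbation [CompleteSpace A]
    (hex : ∀ b, S b = 0 → ∃ a, T a = b) (hzero : ∀ a, S' (T' a) = 0)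
    (hδ : 0 ≤ δ) (hT : ∀ a, ‖T a - T' a‖ ≤ δ * ‖a‖) (hS : ∀ b, ‖S b - S' b‖ ≤ δ * ‖b‖)
    (hTκ : kappa T ≠ 0) (hSκ : kappa S ≠ 0) :
    (1 - 2 * ENNReal.ofReal δ / kappa S) * kappa T - ENNReal.ofReal δ ≤ kappa T' ∧
      (1 - 2 * ENNReal.ofReal δ / kappa T) * kappa S - ENNReal.ofReal δ ≤ kappa S' := by
  refine ⟨tsub_mul_tsub_le_of_forall_lt hSκ hδ fun s r hs hr hs' hr' hp => ?_,
    tsub_mul_tsub_le_of_forall_lt hTκ hδ fun r s hr hs hr' hs' hp => ?_⟩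
  · refine LiftsWith.ofReal_le_kappa hp.le fun a => ?_
    exact exists_preimage_of_perturbation hex hzero hδ hT hS hr (liftsWith_of_lt_kappa T hr hr')
      hs (liftsWith_of_lt_kappa S hs hs') hp (T' a) (hzero a)
  · exact (ofReal_le_kappa_iff S' hp.le).2 fun b => bounded_below_of_perturbation hex hzero hδ hT
      hS hr (liftsWith_of_lt_kappa T hr hr') hs (liftsWith_of_lt_kappa S hs hs') b

end Banach

/-! ### Cochains as a Banach space -/

section CochainSpaces

variable {V : Type v} {Γ : Type u} [Group Γ] [MulAction Γ V]
variable {X : AbstractSimplicialComplex V} {k : ℕ}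

theorem FundamentalDomain.finite_simplices {m : ℕ} (hX : IsEilenbergMacLane Γ X m)
    (F : FundamentalDomain Γ X) (hk : k ≤ m) : Finite (F.simplices k) := by
  obtain ⟨T, hT, h⟩ := hX.finite_skeleton
  have := hT.to_subtype
  choose γ hγ using fun s : F.simplices k => h s.1 (F.subset _ s.2.1) (by rw [s.2.2]; omega)
  refine Finite.of_injective (fun s => (⟨translate (γ s) s.1, hγ s⟩ : T)) fun s t hst => ?_
  have hst' : translate (γ s) s.1 = translate (γ t) t.1 := congrArg Subtype.val hst
  have hmul : ∀ (a b : Γ) (r : Finset V), translate (a * b) r = translate a (translate b r) := by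
    intro a b r
    simp only [translate, Finset.map_map]
    congr 1
    ext c
    simp [mul_smul]
  have hone : ∀ r : Finset V, translate (1 : Γ) r = r := by
    intro r
    ext a
    simp [translate]
  have h1 : translate ((γ t)⁻¹ * γ s) s.1 = t.1 := by
    rw [hmul, hst', ← hmul, inv_mul_cancel, hone]
  have h2 : (γ t)⁻¹ * γ s = 1 := (F.existsUnique s.1 (F.subset _ s.2.1)).unique
    (by rw [h1]; exact t.2.1) (by rw [hone]; exact s.2.1)
  rw [h2, hone] at h1
  exact Subtype.ext h1

theorem OrdSimplex.exists_perm (σ τ : OrdSimplex X k) (h : σ.verts = τ.verts) :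
    ∃ e : Equiv.Perm (Fin (k + 1)), σ = τ.perm e := by
  have hr : Set.range σ.1 = Set.range τ.1 := by
    have := congrArg (fun s : Finset V => (s : Set V)) h
    simpa [OrdSimplex.verts] using this
  refine ⟨(Equiv.ofInjective σ.1 σ.1.injective).trans ((Equiv.setCongr hr).trans
    (Equiv.ofInjective τ.1 τ.1.injective).symm), Subtype.ext ?_⟩
  ext i
  have := Equiv.apply_ofInjective_symm τ.1.injective
    ((Equiv.setCongr hr) (Equiv.ofInjective σ.1 σ.1.injective i))
  simpa [OrdSimplex.perm] using this.symm

theorem FundamentalDomain.verts_order (F : FundamentalDomain Γ X) (s : F.simplices k) :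
    (F.order s).verts = s.1 := by
  simp only [OrdSimplex.verts, FundamentalDomain.order]
  rw [← Finset.map_map, Finset.map_univ_equiv, Finset.univ_eq_attach, Finset.attach_map_val]

variable {𝕜 : Type w} [RCLike 𝕜] {E : Type x} [NormedAddCommGroup E] [NormedSpace 𝕜 E]

/-- A cochain is determined by its values on the ordered simplices of the fundamental domain: its
value at `σ` is, up to a sign, the value at one of them. -/
theorem exists_eq_sign_smul (hX : ∀ (γ : Γ), ∀ s ∈ X, translate γ s ∈ X)
    (F : FundamentalDomain Γ X) (σ : OrdSimplex X k) :
    ∃ (s : F.simplices k) (u : ℤˣ), ∀ f ∈ cochainSubmodule Γ 𝕜 E X k,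
      f σ = u • f (F.order s) := by
  set γ := F.toDomain σ
  have hτ : Finset.univ.map (σ.1.trans (MulAction.toPerm γ).toEmbedding) =
      translate γ σ.verts := by
    simp only [translate, OrdSimplex.verts, Finset.map_map]
  let τ : OrdSimplex X k := ⟨σ.1.trans (MulAction.toPerm γ).toEmbedding, by
    rw [hτ]; exact hX _ _ σ.2⟩
  let s : F.simplices k := ⟨translate γ σ.verts, F.toDomain_spec σ, by
    simp [translate, OrdSimplex.verts]⟩
  obtain ⟨e, he⟩ := OrdSimplex.exists_perm τ (F.order s) (by rw [F.verts_order]; exact hτ)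
  refine ⟨s, Equiv.Perm.sign e, fun f hf => ?_⟩
  rw [← hf.1, ← he]
  exact (hf.2 γ σ τ fun i => rfl).symm

theorem continuous_intUnits_smul {Y : Type*} [TopologicalSpace Y] (u : ℤˣ) {g : Y → E}
    (hg : Continuous g) : Continuous fun y => u • g y := by
  rcases Int.units_eq_one_or u with rfl | rfl
  · simpa using hg
  · simpa only [Units.neg_smul, one_smul, ← Pi.neg_def] using hg.neg

variable (𝕜 E) in
theorem isClosed_cochainSubmodule (X : AbstractSimplicialComplex V) (k : ℕ) :
    IsClosed (cochainSubmodule Γ 𝕜 E X k : Set (OrdSimplex X k → E)) := by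
  have : (cochainSubmodule Γ 𝕜 E X k : Set (OrdSimplex X k → E)) =
      (⋂ (σ) (e : Equiv.Perm (Fin (k + 1))), {f | f (σ.perm e) = Equiv.Perm.sign e • f σ}) ∩
      ⋂ (γ : Γ) (σ : OrdSimplex X k) (τ : OrdSimplex X k) (_ : ∀ i, τ.1 i = γ • σ.1 i),
        {f | f τ = f σ} := by
    ext f
    simp only [Set.mem_inter_iff, Set.mem_iInter]
    rfl
  rw [this]
  refine (isClosed_iInter fun σ => isClosed_iInter fun e => ?_).inter
    (isClosed_iInter fun γ => isClosed_iInter fun σ => isClosed_iInter fun τ =>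
      isClosed_iInter fun _ => ?_)
  · exact isClosed_eq (continuous_apply _) (continuous_intUnits_smul _ (continuous_apply _))
  · exact isClosed_eq (continuous_apply _) (continuous_apply _)

theorem Cochain.continuous_eval (σ : OrdSimplex X k) :
    Continuous fun f : Cochain Γ 𝕜 E X k => f.1 σ :=
  (continuous_apply σ).comp continuous_subtype_val

theorem Cochain.continuous_iff {Y : Type*} [TopologicalSpace Y] {g : Y → Cochain Γ 𝕜 E X k} :
    Continuous g ↔ ∀ σ, Continuous fun y => (g y).1 σ :=
  ⟨fun h σ => (Cochain.continuous_eval σ).comp h,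
    fun h => Continuous.subtype_mk (continuous_pi h) fun y => (g y).2⟩

theorem continuous_coboundary (F : FundamentalDomain Γ X) (π : Γ →* (E →L[𝕜] E)) (k : ℕ) :
    Continuous (coboundary F π k) := by
  refine Cochain.continuous_iff.2 fun σ => ?_
  change Continuous fun f : Cochain Γ 𝕜 E X k => coboundaryFun F π k f.1 σ
  unfold coboundaryFun
  refine continuous_finsetSum _ fun i _ => Continuous.const_smul ?_ _
  exact (π _).continuous.comp ((π _).continuous.comp (Cochain.continuous_eval _))

/-- The codifferential squares to zero: the isomorphism `f ↦ (σ ↦ π(γ_σ)⁻¹ f(σ))` onto equivariant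
cochains carries it to the usual simplicial one. -/
theorem coboundary_comp_coboundary (F : FundamentalDomain Γ X) (π : Γ →* (E →L[𝕜] E)) (k : ℕ)
    (f : Cochain Γ 𝕜 E X k) : coboundary F π (k + 1) (coboundary F π k f) = 0 := by
  apply Subtype.ext
  funext σ
  change coboundaryFun F π (k + 1) (coboundaryFun F π k f.1) σ = 0
  let h : OrdSimplex X k → E := fun τ => π (F.toDomain τ)⁻¹ (f.1 τ)
  have h1 : coboundaryFun F π (k + 1) (coboundaryFun F π k f.1) σ =
      π (F.toDomain σ) (∑ x : Fin (k + 3) × Fin (k + 2),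
        (-1 : 𝕜) ^ (x.1 + x.2 : ℕ) • h ((σ.face x.1).face x.2)) := by
    rw [Fintype.sum_prod_type, map_sum]
    refine Finset.sum_congr rfl fun i _ => ?_
    rw [← map_smul]
    congr 1
    simp only [coboundaryFun, map_sum, Finset.smul_sum, map_smul, smul_smul, ← pow_add]
    refine Finset.sum_congr rfl fun j _ => ?_
    congr 1
    rw [← mul_apply_eq_comp, ← map_mul, inv_mul_cancel, map_one, one_apply_eq_self]
  rw [h1]
  convert map_zero (π (F.toDomain σ))
  have hface : ∀ (i : Fin (k + 3)) (j : Fin (k + 2)),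
      (σ.face (i.succAbove j)).face (j.predAbove i) = (σ.face i).face j := by
    intro i j
    apply Subtype.ext
    ext l
    simp [OrdSimplex.face, Fin.succAbove_succAbove_succAbove_predAbove]
  -- Omitting two vertices in either order gives the same face with opposite signs.
  refine Finset.sum_involution (fun x _ => (x.1.succAbove x.2, x.2.predAbove x.1)) ?_ ?_ ?_ ?_
  · rintro ⟨i, j⟩ -
    simp only
    rw [hface, Fin.neg_one_pow_succAbove_add_predAbove, neg_smul, add_neg_cancel]
  · rintro ⟨i, j⟩ - - heq
    exact Fin.succAbove_ne i j (congrArg Prod.fst heq)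
  · simp
  · rintro ⟨i, j⟩ -
    simp [Fin.succAbove_succAbove_predAbove, Fin.predAbove_predAbove_succAbove]

variable (F : FundamentalDomain Γ X) (p : ℝ)

/-- The values of a cochain on the simplices of the fundamental domain, with the `ℓ^p` norm. -/
def restrictToDomain (k : ℕ) :
    Cochain Γ 𝕜 E X k →ₗ[𝕜] PiLp (ENNReal.ofReal p) fun _ : F.simplices k => E where
  toFun f := WithLp.toLp _ fun s => f.1 (F.order s)
  map_add' _ _ := rfl
  map_smul' _ _ := rfl

@[simp]
theorem restrictToDomain_apply (f : Cochain Γ 𝕜 E X k) (s : F.simplices k) :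
    restrictToDomain F p k f s = f.1 (F.order s) :=
  rfl

variable (𝕜 E) in
/-- The space of cochains with the norm `‖·‖_p`, realized as the subspace of the restrictions of
cochains to the fundamental domain. -/
abbrev LpCochain (k : ℕ) : Submodule 𝕜 (PiLp (ENNReal.ofReal p) fun _ : F.simplices k => E) :=
  LinearMap.range (restrictToDomain (𝕜 := 𝕜) (E := E) F p k)

theorem exists_continuousLinearEquiv_lpCochain
    (hX : ∀ (γ : Γ), ∀ s ∈ X, translate γ s ∈ X) (k : ℕ) :
    IsClosed (LpCochain 𝕜 E F p k : Set (PiLp (ENNReal.ofReal p) fun _ : F.simplices k => E)) ∧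
      ∃ e : Cochain Γ 𝕜 E X k ≃L[𝕜] LpCochain 𝕜 E F p k,
        ∀ f, (e f : PiLp (ENNReal.ofReal p) fun _ : F.simplices k => E) =
          restrictToDomain F p k f := by
  choose t u htu using fun σ : OrdSimplex X k => exists_eq_sign_smul (𝕜 := 𝕜) (E := E) hX F σ
  let ext : (PiLp (ENNReal.ofReal p) fun _ : F.simplices k => E) → OrdSimplex X k → E :=
    fun x σ => u σ • x (t σ)
  have hext : Continuous ext := continuous_pi fun σ =>
    continuous_intUnits_smul _ (PiLp.continuous_apply _ _ _)
  have hres : ∀ f : Cochain Γ 𝕜 E X k, ext (restrictToDomain F p k f) = f.1 := fun f =>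
    funext fun σ => (htu σ f.1 f.2).symm
  constructor
  · have : (LpCochain 𝕜 E F p k : Set (PiLp (ENNReal.ofReal p) fun _ : F.simplices k => E)) =
        {x | ext x ∈ (cochainSubmodule Γ 𝕜 E X k : Set (OrdSimplex X k → E))} ∩
          ⋂ s, {x | ext x (F.order s) = x s} := by
      ext x
      simp only [Set.mem_inter_iff, Set.mem_iInter]
      constructor
      · rintro ⟨f, rfl⟩
        refine ⟨?_, fun s => ?_⟩
        · change ext _ ∈ cochainSubmodule Γ 𝕜 E X k
          rw [hres]; exact f.2
        · change ext _ _ = _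
          rw [hres]; rfl
      · rintro ⟨h1, h2⟩
        exact ⟨⟨ext x, h1⟩, PiLp.ext h2⟩
    rw [this]
    exact ((isClosed_cochainSubmodule 𝕜 E X k).preimage hext).inter
      (isClosed_iInter fun s => isClosed_eq ((continuous_apply _).comp hext)
        (PiLp.continuous_apply _ _ _))
  · have hinj : Function.Injective (restrictToDomain (𝕜 := 𝕜) (E := E) F p k) := fun f g hfg =>
      Subtype.ext (by rw [← hres f, ← hres g, hfg])
    let e := LinearEquiv.ofInjective (restrictToDomain (𝕜 := 𝕜) (E := E) F p k) hinj
    refine ⟨⟨e, ?_, ?_⟩, fun f => rfl⟩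
    · refine Continuous.subtype_mk ?_ _
      exact (PiLp.continuous_toLp _ _).comp
        (continuous_pi fun s => Cochain.continuous_eval (F.order s))
    · refine Cochain.continuous_iff.2 fun σ => ?_
      have : ∀ y, (e.symm y).1 = ext y.1 := fun y => by
        rw [← hres (e.symm y)]
        congr 1
        exact congrArg Subtype.val (e.apply_symm_apply y)
      change Continuous fun y => (e.symm y).1 σ
      simp only [this]
      exact (continuous_apply σ).comp (hext.comp continuous_subtype_val)

variable {F p}

theorem norm_restrictToDomain [Fintype (F.simplices k)] [Fact (1 ≤ ENNReal.ofReal p)] (hp : 1 ≤ p)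
    (f : Cochain Γ 𝕜 E X k) : ‖restrictToDomain F p k f‖ = cochainNorm F p f := by
  have h : (ENNReal.ofReal p).toReal = p := ENNReal.toReal_ofReal (by linarith)
  rw [PiLp.norm_eq_sum (by rw [h]; linarith), h, cochainNorm, tsum_fintype]
  rfl

theorem norm_apply_le_cochainNorm [Fintype (F.simplices k)]
    (hX : ∀ (γ : Γ), ∀ s ∈ X, translate γ s ∈ X) (hp : 1 ≤ p)
    (f : Cochain Γ 𝕜 E X k) (σ : OrdSimplex X k) : ‖f.1 σ‖ ≤ cochainNorm F p f := by
  have : Fact (1 ≤ ENNReal.ofReal p) := ⟨by simpa using hp⟩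
  obtain ⟨s, u, hsu⟩ := exists_eq_sign_smul (𝕜 := 𝕜) (E := E) hX F σ
  rw [hsu f.1 f.2, ← norm_restrictToDomain hp]
  refine le_trans (le_of_eq ?_) (PiLp.norm_apply_le (restrictToDomain F p k f) s)
  rcases Int.units_eq_one_or u with rfl | rfl
  · simp
  · simp

theorem cochainNorm_le_sum [Fintype (F.simplices k)] (hp : 1 ≤ p) (f : Cochain Γ 𝕜 E X k) :
    cochainNorm F p f ≤ ∑ s : F.simplices k, ‖f.1 (F.order s)‖ := by
  classical
  have : Fact (1 ≤ ENNReal.ofReal p) := ⟨by simpa using hp⟩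
  rw [← norm_restrictToDomain hp]
  have h : restrictToDomain F p k f =
      ∑ s, PiLp.single (ENNReal.ofReal p) s (f.1 (F.order s)) := by
    ext s
    simp [Pi.single_apply]
  rw [h]
  refine (norm_sum_le _ _).trans (le_of_eq (Finset.sum_congr rfl fun s _ => ?_))
  exact PiLp.norm_single _ _ _ _

end CochainSpaces

/-! ### Deformations of representations -/

section Deformations

variable {Γ : Type u} [Group Γ]
variable {𝕜 : Type w} [RCLike 𝕜] {E : Type x} [NormedAddCommGroup E] [NormedSpace 𝕜 E]

/-- Closeness on the generators propagates linearly to every group element. The bound on `ε`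
controls the norms of the operators of the deformation at the inverses of the generators. -/
theorem exists_norm_sub_le_of_isDeformation (S : Finset Γ)
    (hS : Subgroup.closure (S : Set Γ) = ⊤) (π : Γ →* (E →L[𝕜] E)) :
    ∃ ε₀ : ℝ, 0 < ε₀ ∧ ∀ g : Γ, ∃ c : ℝ, 0 ≤ c ∧ ∀ ε : ℝ, 0 < ε → ε ≤ ε₀ →
      ∀ ρ : Γ →* (E →L[𝕜] E), IsDeformation S ε π ρ → ‖π g - ρ g‖ ≤ c * ε := by
  set N : ℝ := ∑ s ∈ S, ‖π s⁻¹‖ with hN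
  have hN0 : 0 ≤ N := Finset.sum_nonneg fun _ _ => norm_nonneg _
  refine ⟨1 / (2 * N + 1), by positivity, fun g => ?_⟩
  have hg : g ∈ Subgroup.closure (S : Set Γ) := by rw [hS]; trivial
  induction hg using Subgroup.closure_induction_left with
  | one => exact ⟨0, le_rfl, fun ε _ _ ρ _ => by simp⟩
  | mul_left s hs g _ ih =>
    obtain ⟨c, hc, h⟩ := ih
    refine ⟨‖π s‖ * c + (‖π g‖ + c * (1 / (2 * N + 1))), by positivity, fun ε hε hε' ρ hρ => ?_⟩
    have h1 := h ε hε hε' ρ hρ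
    have h2 : ‖ρ g‖ ≤ ‖π g‖ + c * (1 / (2 * N + 1)) := by
      have h3 : ‖ρ g‖ ≤ ‖π g‖ + ‖π g - ρ g‖ := by
        simpa using norm_sub_le (π g) (π g - ρ g)
      linarith [mul_le_mul_of_nonneg_left hε' hc]
    have h3 : π (s * g) - ρ (s * g) = π s * (π g - ρ g) + (π s - ρ s) * ρ g := by
      rw [map_mul, map_mul]; noncomm_ring
    rw [h3]
    refine (norm_add_le _ _).trans ?_
    have h4 := (norm_mul_le (π s) (π g - ρ g)).trans
      (mul_le_mul_of_nonneg_left h1 (norm_nonneg _))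
    have h5 := (norm_mul_le (π s - ρ s) (ρ g)).trans
      (mul_le_mul (hρ s hs) h2 (norm_nonneg _) hε.le)
    linarith
  | inv_mul_cancel s hs g _ ih =>
    obtain ⟨c, hc, h⟩ := ih
    refine ⟨‖π s⁻¹‖ * c + ‖π s⁻¹‖ * (2 * ‖π s⁻¹‖) * (‖π g‖ + c * (1 / (2 * N + 1))),
      by positivity, fun ε hε hε' ρ hρ => ?_⟩
    have h1 := h ε hε hε' ρ hρ
    have h2 : ‖ρ g‖ ≤ ‖π g‖ + c * (1 / (2 * N + 1)) := by
      have h3 : ‖ρ g‖ ≤ ‖π g‖ + ‖π g - ρ g‖ := by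
        simpa using norm_sub_le (π g) (π g - ρ g)
      linarith [mul_le_mul_of_nonneg_left hε' hc]
    have hπs : π s⁻¹ * π s = 1 := by rw [← map_mul]; simp
    have hρs : ρ s * ρ s⁻¹ = 1 := by rw [← map_mul]; simp
    have hinv : π s⁻¹ - ρ s⁻¹ = -(π s⁻¹ * (π s - ρ s) * ρ s⁻¹) := by
      rw [mul_sub, sub_mul, hπs, one_mul, mul_assoc, hρs, mul_one]; abel
    have hsN : ‖π s⁻¹‖ ≤ N := Finset.single_le_sum (f := fun s => ‖π s⁻¹‖)
      (fun _ _ => norm_nonneg _) hs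
    have hinvn : ‖π s⁻¹ - ρ s⁻¹‖ ≤ ‖π s⁻¹‖ * ε * ‖ρ s⁻¹‖ := by
      rw [hinv, norm_neg]
      refine (norm_mul_le _ _).trans (mul_le_mul_of_nonneg_right ?_ (norm_nonneg _))
      exact (norm_mul_le _ _).trans (mul_le_mul_of_nonneg_left (hρ s hs) (norm_nonneg _))
    -- `‖π s⁻¹‖ ε ≤ 1/2`, so that `‖ρ s⁻¹‖ ≤ 2 ‖π s⁻¹‖`.
    have hhalf : ‖π s⁻¹‖ * ε ≤ 1 / 2 := by
      have h3 : N * (1 / (2 * N + 1)) ≤ 1 / 2 := by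
        rw [mul_one_div, div_le_div_iff₀ (by positivity) two_pos]; linarith
      exact (mul_le_mul hsN hε' hε.le hN0).trans h3
    have hρinv : ‖ρ s⁻¹‖ ≤ 2 * ‖π s⁻¹‖ := by
      have h3 : ‖ρ s⁻¹‖ ≤ ‖π s⁻¹‖ + ‖π s⁻¹ - ρ s⁻¹‖ := by
        simpa using norm_sub_le (π s⁻¹) (π s⁻¹ - ρ s⁻¹)
      linarith [mul_le_mul_of_nonneg_right hhalf (norm_nonneg (ρ s⁻¹))]
    have h3 : π (s⁻¹ * g) - ρ (s⁻¹ * g) =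
        π s⁻¹ * (π g - ρ g) + (π s⁻¹ - ρ s⁻¹) * ρ g := by
      rw [map_mul, map_mul]; noncomm_ring
    rw [h3]
    refine (norm_add_le _ _).trans ?_
    have h4 := (norm_mul_le (π s⁻¹) (π g - ρ g)).trans
      (mul_le_mul_of_nonneg_left h1 (norm_nonneg _))
    have h5 : ‖(π s⁻¹ - ρ s⁻¹) * ρ g‖ ≤
        (‖π s⁻¹‖ * ε * (2 * ‖π s⁻¹‖)) * (‖π g‖ + c * (1 / (2 * N + 1))) :=
      (norm_mul_le _ _).trans (mul_le_mul
        (hinvn.trans (mul_le_mul_of_nonneg_left hρinv (by positivity))) h2 (norm_nonneg _)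
        (by positivity))
    linarith

variable {V : Type v} [MulAction Γ V] {X : AbstractSimplicialComplex V}

theorem exists_coboundary_sub_le {S : Finset Γ} {π : Γ →* (E →L[𝕜] E)} {ε₀ : ℝ}
    (h : ∀ g : Γ, ∃ c : ℝ, 0 ≤ c ∧ ∀ ε : ℝ, 0 < ε → ε ≤ ε₀ →
      ∀ ρ : Γ →* (E →L[𝕜] E), IsDeformation S ε π ρ → ‖π g - ρ g‖ ≤ c * ε)
    (hX : ∀ (γ : Γ), ∀ s ∈ X, translate γ s ∈ X) (F : FundamentalDomain Γ X) (k : ℕ)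
    [Finite (F.simplices k)] [Finite (F.simplices (k + 1))] {p : ℝ} (hp : 1 ≤ p) :
    ∃ A : ℝ, 0 ≤ A ∧ ∀ ε : ℝ, 0 < ε → ε ≤ ε₀ → ∀ ρ : Γ →* (E →L[𝕜] E), IsDeformation S ε π ρ →
      ∀ f, cochainNorm F p (coboundary F π k f - coboundary F ρ k f) ≤
        A * ε * cochainNorm F p f := by
  have := Fintype.ofFinite (F.simplices k)
  have := Fintype.ofFinite (F.simplices (k + 1))
  choose c hc h using h
  let g : F.simplices (k + 1) → Fin (k + 2) → Γ := fun s i =>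
    F.toDomain (F.order s) * (F.toDomain ((F.order s).face i))⁻¹
  refine ⟨∑ s, ∑ i, c (g s i),
    Finset.sum_nonneg fun s _ => Finset.sum_nonneg fun i _ => hc _, fun ε hε hε' ρ hρ f => ?_⟩
  refine (cochainNorm_le_sum hp _).trans ?_
  rw [Finset.sum_mul, Finset.sum_mul]
  refine Finset.sum_le_sum fun s _ => ?_
  rw [Finset.sum_mul, Finset.sum_mul]
  have h1 : (coboundary F π k f - coboundary F ρ k f).1 (F.order s) =
      ∑ i : Fin (k + 2), (-1 : 𝕜) ^ (i : ℕ) •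
        (π (g s i) - ρ (g s i)) (f.1 ((F.order s).face i)) := by
    change coboundaryFun F π k f.1 _ - coboundaryFun F ρ k f.1 _ = _
    simp only [coboundaryFun, ← Finset.sum_sub_distrib, ← smul_sub]
    refine Finset.sum_congr rfl fun i _ => ?_
    simp [g, map_mul]
  rw [h1]
  refine (norm_sum_le _ _).trans (Finset.sum_le_sum fun i _ => ?_)
  rw [norm_smul, norm_pow, norm_neg, norm_one, one_pow, one_mul]
  exact (ContinuousLinearMap.le_opNorm _ _).trans (mul_le_mul (h _ ε hε hε' ρ hρ)
    (norm_apply_le_cochainNorm hX hp f _) (norm_nonneg _) (mul_nonneg (hc _) hε.le))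

end Deformations

/-! ### The cochain complex in degrees `m`, `m + 1`, `m + 2` -/

section Transport

variable {V : Type v} {Γ : Type u} [Group Γ] [MulAction Γ V]
variable {𝕜 : Type w} [RCLike 𝕜] {E : Type x} [NormedAddCommGroup E] [NormedSpace 𝕜 E]
variable {X : AbstractSimplicialComplex V} (F : FundamentalDomain Γ X)
variable {A B C : Type*} [NormedAddCommGroup A] [NormedSpace 𝕜 A]
  [NormedAddCommGroup B] [NormedSpace 𝕜 B] [NormedAddCommGroup C] [NormedSpace 𝕜 C]

/-- The codifferential as a bounded operator between normed spaces isomorphic to the spaces of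
cochains. -/
def coboundaryCLM {k : ℕ} (eA : Cochain Γ 𝕜 E X k ≃L[𝕜] A) (eB : Cochain Γ 𝕜 E X (k + 1) ≃L[𝕜] B)
    (π : Γ →* (E →L[𝕜] E)) : A →L[𝕜] B :=
  eB.toContinuousLinearMap ∘L ⟨coboundary F π k, continuous_coboundary F π k⟩ ∘L
    eA.symm.toContinuousLinearMap

variable {F}

theorem coboundaryCLM_apply {k : ℕ} (eA : Cochain Γ 𝕜 E X k ≃L[𝕜] A)
    (eB : Cochain Γ 𝕜 E X (k + 1) ≃L[𝕜] B) (π : Γ →* (E →L[𝕜] E)) (f : Cochain Γ 𝕜 E X k) :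
    coboundaryCLM F eA eB π (eA f) = eB (coboundary F π k f) := by
  simp [coboundaryCLM]

theorem coboundaryCLM_eq_zero_iff {k : ℕ} (eA : Cochain Γ 𝕜 E X k ≃L[𝕜] A)
    (eB : Cochain Γ 𝕜 E X (k + 1) ≃L[𝕜] B) (π : Γ →* (E →L[𝕜] E)) (f : Cochain Γ 𝕜 E X k) :
    coboundaryCLM F eA eB π (eA f) = 0 ↔ f ∈ cocycles F π k := by
  rw [coboundaryCLM_apply, map_eq_zero_iff eB eB.injective]
  exact LinearMap.mem_ker.symm

theorem kazhdanConstant_eq_kappa {k : ℕ} {p : ℝ} (eA : Cochain Γ 𝕜 E X k ≃L[𝕜] A)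
    (eB : Cochain Γ 𝕜 E X (k + 1) ≃L[𝕜] B) (hA : ∀ f, ‖eA f‖ = cochainNorm F p f)
    (hB : ∀ f, ‖eB f‖ = cochainNorm F p f) (π : Γ →* (E →L[𝕜] E)) :
    kazhdanConstant F p π k = kappa (coboundaryCLM F eA eB π) := by
  have hker : ∀ f, eA f ∈ (coboundaryCLM F eA eB π).ker ↔ f ∈ cocycles F π k :=
    coboundaryCLM_eq_zero_iff eA eB π
  unfold kazhdanConstant kappa
  refine Equiv.iInf_congr eA.toEquiv fun f => ?_
  refine iInf_congr_Prop (not_congr (hker f)) fun _ => ?_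
  congr 1
  · rw [← hB, ← coboundaryCLM_apply eA eB]
    rfl
  · refine (Equiv.iInf_congr (eA.toEquiv.subtypeEquiv fun f => (hker f).symm) fun v => ?_).symm
    rw [← hA, map_add]
    rfl

theorem isReduced_iff_isClosed_range {k : ℕ} (eA : Cochain Γ 𝕜 E X k ≃L[𝕜] A)
    (eB : Cochain Γ 𝕜 E X (k + 1) ≃L[𝕜] B) (π : Γ →* (E →L[𝕜] E)) :
    IsReduced F π (k + 1) ↔ IsClosed ((coboundaryCLM F eA eB π).range : Set B) := by
  rw [← eB.toHomeomorph.isClosed_preimage]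
  unfold IsReduced
  have : (eB.toHomeomorph ⁻¹' ((coboundaryCLM F eA eB π).range : Set B)) =
      (coboundaries F π (k + 1) : Set (Cochain Γ 𝕜 E X (k + 1))) := by
    ext g
    constructor
    · rintro ⟨a, ha⟩
      obtain ⟨f, rfl⟩ := eA.surjective a
      exact ⟨f, eB.injective ((coboundaryCLM_apply eA eB π f).symm.trans ha)⟩
    · rintro ⟨f, rfl⟩
      exact ⟨eA f, coboundaryCLM_apply eA eB π f⟩
  rw [this]

theorem subsingleton_cohomology_iff (π : Γ →* (E →L[𝕜] E)) (k : ℕ) :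
    Subsingleton (Cohomology F π (k + 1)) ↔
      ∀ g ∈ cocycles F π (k + 1), ∃ f, coboundary F π k f = g := by
  rw [Submodule.Quotient.subsingleton_iff, Submodule.submoduleOf_eq_top]
  rfl

variable {m : ℕ} (eA : Cochain Γ 𝕜 E X m ≃L[𝕜] A) (eB : Cochain Γ 𝕜 E X (m + 1) ≃L[𝕜] B)
  (eC : Cochain Γ 𝕜 E X (m + 2) ≃L[𝕜] C) {p : ℝ} {π : Γ →* (E →L[𝕜] E)}

theorem subsingleton_cohomology_iff_exact (π : Γ →* (E →L[𝕜] E)) :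
    Subsingleton (Cohomology F π (m + 1)) ↔
      ∀ b, coboundaryCLM F eB eC π b = 0 → ∃ a, coboundaryCLM F eA eB π a = b := by
  rw [subsingleton_cohomology_iff]
  constructor
  · intro h b hb
    obtain ⟨g, rfl⟩ := eB.surjective b
    obtain ⟨f, rfl⟩ := h g ((coboundaryCLM_eq_zero_iff eB eC π g).1 hb)
    exact ⟨eA f, coboundaryCLM_apply eA eB π f⟩
  · intro h g hg
    obtain ⟨a, ha⟩ := h (eB g) ((coboundaryCLM_eq_zero_iff eB eC π g).2 hg)
    obtain ⟨f, rfl⟩ := eA.surjective a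
    exact ⟨f, eB.injective ((coboundaryCLM_apply eA eB π f).symm.trans ha)⟩

theorem coboundaryCLM_comp (ρ : Γ →* (E →L[𝕜] E)) (a : A) :
    coboundaryCLM F eB eC ρ (coboundaryCLM F eA eB ρ a) = 0 := by
  obtain ⟨f, rfl⟩ := eA.surjective a
  rw [coboundaryCLM_apply, coboundaryCLM_apply, coboundary_comp_coboundary, map_zero]

variable {eA eB} in
theorem norm_coboundaryCLM_sub_le {ρ : Γ →* (E →L[𝕜] E)} {δ : ℝ}
    (hA : ∀ f, ‖eA f‖ = cochainNorm F p f) (hB : ∀ f, ‖eB f‖ = cochainNorm F p f)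
    (h : ∀ f, cochainNorm F p (coboundary F π m f - coboundary F ρ m f) ≤
      δ * cochainNorm F p f) (a : A) :
    ‖coboundaryCLM F eA eB π a - coboundaryCLM F eA eB ρ a‖ ≤ δ * ‖a‖ := by
  obtain ⟨f, rfl⟩ := eA.surjective a
  rw [coboundaryCLM_apply, coboundaryCLM_apply, ← map_sub, hA, hB]
  exact h f

/-- Vanishing and closed range give positive lifting constants for both codifferentials. -/
theorem exists_liftsWith_coboundaryCLM [CompleteSpace A] [CompleteSpace B] [CompleteSpace C]
    (hvan : Subsingleton (Cohomology F π (m + 1))) (hred : IsReduced F π (m + 2)) :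
    ∃ r s : ℝ, 0 < r ∧ LiftsWith (coboundaryCLM F eA eB π) r ∧
      0 < s ∧ LiftsWith (coboundaryCLM F eB eC π) s := by
  obtain ⟨s, hs, hs'⟩ := exists_liftsWith_of_isClosed_range (coboundaryCLM F eB eC π)
    ((isReduced_iff_isClosed_range eB eC π).1 hred)
  have hr : ((coboundaryCLM F eA eB π).range : Set B) = ((coboundaryCLM F eB eC π).ker : Set B) := by
    ext b
    constructor
    · rintro ⟨a, rfl⟩
      exact coboundaryCLM_comp eA eB eC π a
    · exact (subsingleton_cohomology_iff_exact eA eB eC π).1 hvan b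
  obtain ⟨r, hr, hr'⟩ := exists_liftsWith_of_isClosed_range (coboundaryCLM F eA eB π)
    (by rw [hr]; exact (coboundaryCLM F eB eC π).isClosed_ker)
  exact ⟨r, s, hr, hr', hs, hs'⟩

/-- Vanishing in degree `m + 1` and reducedness in degree `m + 2` are stable under perturbations of
the codifferentials that are small in norm. -/
theorem exists_stability_radius [CompleteSpace A] [CompleteSpace B] [CompleteSpace C]
    (hA : ∀ f, ‖eA f‖ = cochainNorm F p f) (hB : ∀ f, ‖eB f‖ = cochainNorm F p f)
    (hC : ∀ f, ‖eC f‖ = cochainNorm F p f)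
    (hvan : Subsingleton (Cohomology F π (m + 1))) (hred : IsReduced F π (m + 2)) :
    ∃ δ₀ : ℝ, 0 < δ₀ ∧ ∀ δ : ℝ, 0 ≤ δ → δ ≤ δ₀ → ∀ ρ : Γ →* (E →L[𝕜] E),
      (∀ f, cochainNorm F p (coboundary F π m f - coboundary F ρ m f) ≤
        δ * cochainNorm F p f) →
      (∀ f, cochainNorm F p (coboundary F π (m + 1) f - coboundary F ρ (m + 1) f) ≤
        δ * cochainNorm F p f) →
      Subsingleton (Cohomology F ρ (m + 1)) ∧ IsReduced F ρ (m + 2) := by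
  obtain ⟨r, s, hr, hr', hs, hs'⟩ := exists_liftsWith_coboundaryCLM eA eB eC hvan hred
  have hex := (subsingleton_cohomology_iff_exact eA eB eC π).1 hvan
  -- For this radius both `(1 - 2δ/s) r - δ` and `(1 - 2δ/r) s - δ` are positive.
  refine ⟨r * s / (4 * (r + s)), by positivity, fun δ hδ hδ' ρ hT hS => ?_⟩
  rw [le_div_iff₀ (by positivity)] at hδ'
  have hrs : 0 < r * s := mul_pos hr hs
  have h1 : 0 < (1 - 2 * δ / s) * r - δ := by
    have : (1 - 2 * δ / s) * r - δ = (r * s - 2 * δ * r - δ * s) / s := by field_simp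
    rw [this]
    exact div_pos (by nlinarith [mul_nonneg hδ hr.le, mul_nonneg hδ hs.le]) hs
  have h2 : 0 < (1 - 2 * δ / r) * s - δ := by
    have : (1 - 2 * δ / r) * s - δ = (r * s - 2 * δ * s - δ * r) / r := by field_simp
    rw [this]
    exact div_pos (by nlinarith [mul_nonneg hδ hr.le, mul_nonneg hδ hs.le]) hr
  have hT' := norm_coboundaryCLM_sub_le hA hB hT
  have hS' := norm_coboundaryCLM_sub_le hB hC hS
  have hzero := coboundaryCLM_comp (F := F) eA eB eC ρ
  refine ⟨(subsingleton_cohomology_iff_exact eA eB eC ρ).2 fun b hb => ?_,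
    (isReduced_iff_isClosed_range eB eC ρ).2 (isClosed_range_of_bounded_below _ h2
      (bounded_below_of_perturbation hex hzero hδ hT' hS' hr hr' hs hs'))⟩
  obtain ⟨a, ha, -⟩ :=
    exists_preimage_of_perturbation hex hzero hδ hT' hS' hr hr' hs hs' h1 b hb
  exact ⟨a, ha⟩

theorem kazhdanConstant_perturbation [CompleteSpace A] [CompleteSpace B] [CompleteSpace C]
    (hA : ∀ f, ‖eA f‖ = cochainNorm F p f) (hB : ∀ f, ‖eB f‖ = cochainNorm F p f)
    (hC : ∀ f, ‖eC f‖ = cochainNorm F p f)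
    (hvan : Subsingleton (Cohomology F π (m + 1))) (hred : IsReduced F π (m + 2))
    {δ : ℝ} (hδ : 0 ≤ δ) {ρ : Γ →* (E →L[𝕜] E)}
    (hT : ∀ f, cochainNorm F p (coboundary F π m f - coboundary F ρ m f) ≤
      δ * cochainNorm F p f)
    (hS : ∀ f, cochainNorm F p (coboundary F π (m + 1) f - coboundary F ρ (m + 1) f) ≤
      δ * cochainNorm F p f) :
    (1 - 2 * ENNReal.ofReal δ / kazhdanConstant F p π (m + 1)) * kazhdanConstant F p π m -
        ENNReal.ofReal δ ≤ kazhdanConstant F p ρ m ∧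
      (1 - 2 * ENNReal.ofReal δ / kazhdanConstant F p π m) * kazhdanConstant F p π (m + 1) -
        ENNReal.ofReal δ ≤ kazhdanConstant F p ρ (m + 1) := by
  obtain ⟨r, s, hr, hr', hs, hs'⟩ := exists_liftsWith_coboundaryCLM eA eB eC hvan hred
  simp only [kazhdanConstant_eq_kappa eA eB hA hB, kazhdanConstant_eq_kappa eB eC hB hC]
  exact kappa_perturbation ((subsingleton_cohomology_iff_exact eA eB eC π).1 hvan)
    (coboundaryCLM_comp eA eB eC ρ) hδ (norm_coboundaryCLM_sub_le hA hB hT)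
    (norm_coboundaryCLM_sub_le hB hC hS)
    (((ENNReal.ofReal_pos.2 hr).trans_le (hr'.ofReal_le_kappa hr.le)).ne')
    (((ENNReal.ofReal_pos.2 hs).trans_le (hs'.ofReal_le_kappa hs.le)).ne')

end Transport

section IsometricModel

variable {V : Type v} {Γ : Type u} [Group Γ] [MulAction Γ V]
variable {𝕜 : Type w} [RCLike 𝕜] {E : Type x} [NormedAddCommGroup E] [NormedSpace 𝕜 E]
variable {X : AbstractSimplicialComplex V}

/-- With finitely many simplices of dimension `k` in the fundamental domain, the topology of
pointwise convergence on cochains is the Banach space topology of the norm `‖·‖_p`. -/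
theorem exists_isometric_model [CompleteSpace E] (hX : ∀ (γ : Γ), ∀ s ∈ X, translate γ s ∈ X)
    (F : FundamentalDomain Γ X) {p : ℝ} (hp : 1 ≤ p) (k : ℕ) [Finite (F.simplices k)] :
    ∃ (A : Type (max v x)) (_ : NormedAddCommGroup A) (_ : NormedSpace 𝕜 A) (_ : CompleteSpace A)
      (e : Cochain Γ 𝕜 E X k ≃L[𝕜] A), ∀ f, ‖e f‖ = cochainNorm F p f := by
  have := Fintype.ofFinite (F.simplices k)
  have : Fact (1 ≤ ENNReal.ofReal p) := ⟨by simpa using hp⟩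
  obtain ⟨hclosed, e, he⟩ := exists_continuousLinearEquiv_lpCochain (𝕜 := 𝕜) (E := E) F p hX k
  exact ⟨LpCochain 𝕜 E F p k, inferInstance, inferInstance, hclosed.completeSpace_coe, e, fun f => by
    rw [← norm_restrictToDomain hp, ← he]; rfl⟩

end IsometricModel

end DeformCoh

end

theorem theorem1 {V : Type*} {Γ : Type*} [Group Γ] [MulAction Γ V]
    {𝕜 : Type*} [RCLike 𝕜] {E : Type*} [NormedAddCommGroup E] [NormedSpace 𝕜 E] [CompleteSpace E]
    (S : Finset Γ) (hS : Subgroup.closure (S : Set Γ) = ⊤)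
    (n : ℕ) (hn : 1 ≤ n)
    (X : AbstractSimplicialComplex V) (hX : DeformCoh.IsEilenbergMacLane Γ X (n + 1))
    (F : DeformCoh.FundamentalDomain Γ X)
    (π : Γ →* (E →L[𝕜] E))
    (hvan : Subsingleton (DeformCoh.Cohomology F π n))
    (hred : DeformCoh.IsReduced F π (n + 1)) :
    ∃ ε : ℝ, 0 < ε ∧
      (∀ ρ : Γ →* (E →L[𝕜] E), DeformCoh.IsDeformation S ε π ρ →
        Subsingleton (DeformCoh.Cohomology F ρ n) ∧ DeformCoh.IsReduced F ρ (n + 1)) ∧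
      ∀ p : ℝ, 1 ≤ p → ∃ A : ℝ, 0 ≤ A ∧ ∀ ε' : ℝ, 0 < ε' → ε' ≤ ε →
        ∀ ρ : Γ →* (E →L[𝕜] E), DeformCoh.IsDeformation S ε' π ρ →
          (∀ f, DeformCoh.cochainNorm F p
            (DeformCoh.coboundary F π (n - 1) f - DeformCoh.coboundary F ρ (n - 1) f) ≤
              A * ε' * DeformCoh.cochainNorm F p f) ∧
          (∀ f, DeformCoh.cochainNorm F p
            (DeformCoh.coboundary F π n f - DeformCoh.coboundary F ρ n f) ≤
              A * ε' * DeformCoh.cochainNorm F p f) ∧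
          (1 - 2 * ENNReal.ofReal (A * ε') / DeformCoh.kazhdanConstant F p π n) *
              DeformCoh.kazhdanConstant F p π (n - 1) - ENNReal.ofReal (A * ε') ≤
            DeformCoh.kazhdanConstant F p ρ (n - 1) ∧
          (1 - 2 * ENNReal.ofReal (A * ε') / DeformCoh.kazhdanConstant F p π (n - 1)) *
              DeformCoh.kazhdanConstant F p π n - ENNReal.ofReal (A * ε') ≤
            DeformCoh.kazhdanConstant F p ρ n := by
  obtain ⟨m, rfl⟩ : ∃ m, n = m + 1 := ⟨n - 1, by omega⟩
  rw [Nat.add_sub_cancel]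
  have hfin : ∀ k, k ≤ m + 2 → Finite (F.simplices k) := fun k hk => F.finite_simplices hX hk
  have := hfin m (by omega)
  have := hfin (m + 1) (by omega)
  have : Finite (F.simplices (m + 1 + 1)) := hfin (m + 2) le_rfl
  obtain ⟨ε₀, hε₀, hg⟩ := DeformCoh.exists_norm_sub_le_of_isDeformation S hS π
  have hbound : ∀ p : ℝ, 1 ≤ p → ∃ A : ℝ, 0 ≤ A ∧ ∀ ε : ℝ, 0 < ε → ε ≤ ε₀ →
      ∀ ρ : Γ →* (E →L[𝕜] E), DeformCoh.IsDeformation S ε π ρ →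
        (∀ f, DeformCoh.cochainNorm F p
          (DeformCoh.coboundary F π m f - DeformCoh.coboundary F ρ m f) ≤
            A * ε * DeformCoh.cochainNorm F p f) ∧
        (∀ f, DeformCoh.cochainNorm F p
          (DeformCoh.coboundary F π (m + 1) f - DeformCoh.coboundary F ρ (m + 1) f) ≤
            A * ε * DeformCoh.cochainNorm F p f) := by
    intro p hp
    obtain ⟨A₁, hA₁, h₁⟩ := DeformCoh.exists_coboundary_sub_le hg hX.simplicial F m hp
    obtain ⟨A₂, hA₂, h₂⟩ := DeformCoh.exists_coboundary_sub_le hg hX.simplicial F (m + 1) hp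
    refine ⟨max A₁ A₂, le_max_of_le_left hA₁, fun ε hε hε' ρ hρ => ⟨fun f => ?_, fun f => ?_⟩⟩
    · refine (h₁ ε hε hε' ρ hρ f).trans ?_
      have : 0 ≤ DeformCoh.cochainNorm F p f :=
        Real.rpow_nonneg (tsum_nonneg fun _ => Real.rpow_nonneg (norm_nonneg _) _) _
      gcongr
      exact le_max_left _ _
    · refine (h₂ ε hε hε' ρ hρ f).trans ?_
      have : 0 ≤ DeformCoh.cochainNorm F p f :=
        Real.rpow_nonneg (tsum_nonneg fun _ => Real.rpow_nonneg (norm_nonneg _) _) _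
      gcongr
      exact le_max_right _ _
  -- The radius `ε` is found with the norm for `p = 1`; vanishing and reducedness do not involve `p`.
  obtain ⟨a, ha, hA⟩ := hbound 1 le_rfl
  obtain ⟨_, _, _, _, eA, heA⟩ :=
    DeformCoh.exists_isometric_model (𝕜 := 𝕜) (E := E) hX.simplicial F le_rfl m
  obtain ⟨_, _, _, _, eB, heB⟩ :=
    DeformCoh.exists_isometric_model (𝕜 := 𝕜) (E := E) hX.simplicial F le_rfl (m + 1)
  obtain ⟨_, _, _, _, eC, heC⟩ :=
    DeformCoh.exists_isometric_model (𝕜 := 𝕜) (E := E) hX.simplicial F le_rfl (m + 2)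
  obtain ⟨δ₀, hδ₀, hstab⟩ := DeformCoh.exists_stability_radius eA eB eC heA heB heC hvan hred
  refine ⟨min ε₀ (δ₀ / (a + 1)), lt_min hε₀ (by positivity), fun ρ hρ => ?_, fun p hp => ?_⟩
  · have hδ : a * min ε₀ (δ₀ / (a + 1)) ≤ δ₀ := by
      refine (mul_le_mul_of_nonneg_left (min_le_right _ _) ha).trans ?_
      rw [mul_div_assoc', div_le_iff₀ (by positivity)]
      nlinarith
    obtain ⟨h₁, h₂⟩ := hA _ (lt_min hε₀ (by positivity)) (min_le_left _ _) ρ hρ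
    exact hstab _ (mul_nonneg ha (lt_min hε₀ (by positivity)).le) hδ ρ h₁ h₂
  · obtain ⟨A, hA0, hA⟩ := hbound p hp
    obtain ⟨_, _, _, _, eA, heA⟩ :=
      DeformCoh.exists_isometric_model (𝕜 := 𝕜) (E := E) hX.simplicial F hp m
    obtain ⟨_, _, _, _, eB, heB⟩ :=
      DeformCoh.exists_isometric_model (𝕜 := 𝕜) (E := E) hX.simplicial F hp (m + 1)
    obtain ⟨_, _, _, _, eC, heC⟩ :=
      DeformCoh.exists_isometric_model (𝕜 := 𝕜) (E := E) hX.simplicial F hp (m + 2)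
    refine ⟨A, hA0, fun ε hε hε' ρ hρ => ?_⟩
    obtain ⟨h₁, h₂⟩ := hA ε hε (hε'.trans (min_le_left _ _)) ρ hρ
    exact ⟨h₁, h₂, DeformCoh.kazhdanConstant_perturbation eA eB eC heA heB heC hvan hred
      (mul_nonneg hA0 hε.le) h₁ h₂⟩
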